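/- Conventions. Measures are non-negative Borel measures on $\mathbb{R}^d$. A locally finite $\mathbb{C}^l$-valued charge $\mu$ on $\mathbb{R}^d$ is a $\sigma$-additive $\mathbb{C}^l$-valued function on the bounded Borel subsets of $\mathbb{R}^d$ (its variation $|\mu|$ is then finite on bounded sets), and $\operatorname{supp}\mu$ is the support of $|\mu|$. $B_r(x)$ is the closed Euclidean ball. For $\mu\neq 0$ put $$\underline{\dim}_{\mathrm H}\,\mu=\inf\{\alpha:\ \exists\text{ a (bounded) Borel set }F\text{ with }\dim_{\mathrm H}F\le\alpha,\ \mu(F)\ne 0\},$$ and for a locally finite measure $\nu$ and $y\in\operatorname{supp}\nu$ put $$\underline{\dim}_{\mathrm H}\,\nu(y)=\liminf_{r\to 0+}\frac{\log \nu(B_r(y))}{\log r}.$$ For $x\in\mathbb{R}^d$ and $r>0$ let $T_{x,r}[\mu](B)=\mu(x+rB)$. The tangent cone $\operatorname{Tan}[\mu,x]$ is the set of all non-zero locally finite charges $m$ for which there are $c_j>0$ and $r_j\searrow 0$ with $\int f\,d(c_jT_{x,r_j}[\mu])\to\int f\,dm$ for every continuous compactly supported $f$. For $a\in\mathbb{C}^l$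 let $(a\otimes\nu)(B)=\nu(B)a$. We write $\mu\in\mathcal S'(\mathbb{R}^d,\mathbb{C}^l)$ if there is a (necessarily unique) tempered distribution $u\in\mathcal S'(\mathbb{R}^d,\mathbb{C}^l)$ with $\langle u,\varphi\rangle=\int\varphi\,d\mu$ for all $\varphi\in C_c^\infty(\mathbb{R}^d)$; this is the case in particular if $|\mu|(B_R(0))\le CR^N$ for all $R\ge 1$ with some $C,N$. In that case $T_{x,r}[\mu]\in\mathcal S'$ is given by $\langle T_{x,r}[\mu],\varphi\rangle=\langle u,\varphi((\cdot-x)/r)\rangle$ for Schwartz functions $\varphi$. **Theorem 1.2.** Let $\mu$ be a non-zero locally finite $\mathbb{C}^l$-valued charge on $\mathbb{R}^d$ and let $\varepsilon>0$. Then there are $x\in\operatorname{supp}\mu$, $a\in\mathbb{C}^l\setminus\{0\}$ and a non-zero locally finite measure $\nu$ on $\mathbb{R}^d$ such that 1. $a\otimes\nu\in\operatorname{Tan}[\mu,x]$; 2. $0\in\operatorname{supp}\nu$ and $\underline{\dim}_{\mathrm H}\,\nu(0)\le\underline{\dim}_{\mathrm H}\,\mu+\varepsilon$; 3. $\nu$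 is tempered: there are $C,N$ with $\nu(B_R(0))\le CR^N$ for all $R\ge 1$; 4. if $\mu\in\mathcal S'(\mathbb{R}^d,\mathbb{C}^l)$, then $a\otimes\nu$ is tangent to $\mu$ at $x$ in the Schwartz sense: there are $c_j>0$ and $r_j\searrow 0$ with $c_jT_{x,r_j}[\mu]\to a\otimes\nu$ in $\mathcal S'(\mathbb{R}^d,\mathbb{C}^l)$, that is, $c_j\langle T_{x,r_j}[\mu],\varphi\rangle\to\big(\int\varphi\,d\nu\big)a$ for every Schwartz function $\varphi$. -/

import Mathlib

open MeasureTheory Filter Topology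
open scoped ENNReal NNReal SchwartzMap

noncomputable section

/-- The Euclidean space `ℝ^d`. -/
abbrev RSpace (d : ℕ) := EuclideanSpace ℝ (Fin d)

/-- The Hermitian space `ℂ^l`. -/
abbrev CSpace (l : ℕ) := EuclideanSpace ℂ (Fin l)

/-- A locally finite `ℂ^l`-valued charge on `ℝ^d`: a `σ`-additive function on the bounded Borel
sets (its variation on every bounded set is then automatically finite). As a function on all sets
it is extended by the value `0`. -/
@[ext]
structure LocalCharge (d l : ℕ) where
  /-- The value on a bounded Borel set. -/
  toFun : Set (RSpace d) → CSpace l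
  /-- The convention outside of the bounded Borel sets. -/
  eq_zero' : ∀ B, ¬(MeasurableSet B ∧ Bornology.IsBounded B) → toFun B = 0
  /-- `σ`-additivity. -/
  hasSum' : ∀ f : ℕ → Set (RSpace d), (∀ i, MeasurableSet (f i)) →
    Pairwise (Function.onFun Disjoint f) → Bornology.IsBounded (⋃ i, f i) →
    HasSum (fun i => toFun (f i)) (toFun (⋃ i, f i))

namespace LocalCharge

variable {d l : ℕ}

instance : CoeFun (LocalCharge d l) (fun _ => Set (RSpace d) → CSpace l) := ⟨toFun⟩

theorem apply_empty (μ : LocalCharge d l) : μ ∅ = 0 := by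
  have h := μ.hasSum' (fun _ => ∅) (fun _ => MeasurableSet.empty)
    (fun _ _ _ => disjoint_bot_left) (by simp)
  exact (summable_const_iff (β := ℕ) _).1 h.summable

instance : Zero (LocalCharge d l) where
  zero :=
    { toFun := fun _ => 0
      eq_zero' := fun _ _ => rfl
      hasSum' := fun _ _ _ _ => hasSum_zero }

/-- Multiplication of a charge by a real number. -/
instance : SMul ℝ (LocalCharge d l) where
  smul c μ :=
    { toFun := fun B => c • μ B
      eq_zero' := fun B hB => by rw [μ.eq_zero' B hB, smul_zero]
      hasSum' := fun f hf hd hb => (μ.hasSum' f hf hd hb).const_smul c }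

theorem isSigmaSubadditiveSetFun_enorm (μ : LocalCharge d l) :
    IsSigmaSubadditiveSetFun (fun B => ‖μ B‖ₑ) := by
  intro s hs
  by_cases hb : Bornology.IsBounded (⋃ i, (s i).val)
  · have h := (μ.hasSum' (fun i => (s i).val) (fun i => (s i).prop) hs hb).tsum_eq
    simpa only [h] using enorm_tsum_le_tsum_enorm (f := fun i => μ (s i).val)
  · simp [μ.eq_zero' _ (fun h => hb h.2)]

/-- The variation `|μ|`: on a Borel set it is the supremum of `∑ ‖μ (B i)‖` over its finite Borel
partitions (where unbounded pieces `B i` contribute nothing). -/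
def variation (μ : LocalCharge d l) : Measure (RSpace d) :=
  preVariation (fun B => ‖μ B‖ₑ) μ.isSigmaSubadditiveSetFun_enorm (by simp [μ.apply_empty])

/-- The restriction of a locally finite charge to a bounded Borel set, as a vector measure
(and the zero vector measure if `A` is not a bounded Borel set). -/
def restrict (μ : LocalCharge d l) (A : Set (RSpace d)) : VectorMeasure (RSpace d) (CSpace l) where
  measureOf' B := open Classical in
    if MeasurableSet B ∧ MeasurableSet A ∧ Bornology.IsBounded A then μ (B ∩ A) else 0
  empty' := by simp [μ.apply_empty]
  not_measurable' B hB := by simp [hB]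
  m_iUnion' f hf hd := by
    by_cases hA : MeasurableSet A ∧ Bornology.IsBounded A
    · have h := μ.hasSum' (fun i => f i ∩ A) (fun i => (hf i).inter hA.1)
        (fun i j hij => (hd hij).mono Set.inter_subset_left Set.inter_subset_left)
        (hA.2.subset (Set.iUnion_subset fun i => Set.inter_subset_right))
      rw [← Set.iUnion_inter] at h
      simpa [hf, MeasurableSet.iUnion hf, hA.1, hA.2] using h
    · simp [hA, hasSum_zero]

/-- `∫ f dμ ∈ ℂ^l` for a continuous compactly supported function `f`. -/
def integral (μ : LocalCharge d l) (f : RSpace d → ℂ) : CSpace l :=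
  (μ.restrict (tsupport f)).integral f (ContinuousLinearMap.lsmul ℝ ℂ)

/-- The lower Hausdorff dimension of a charge: the infimum of all `α` for which there is a
Borel set `F` with `dim_H F ≤ α` and `μ F ≠ 0`. It suffices to consider bounded sets `F`. -/
def lowerDimH (μ : LocalCharge d l) : ℝ≥0∞ :=
  sInf {α | ∃ F : Set (RSpace d), MeasurableSet F ∧ dimH F ≤ α ∧ μ F ≠ 0}

/-- The dilation `T_{x,r}[μ]`, `r > 0`, i.e. the image of `μ` under `z ↦ (z - x) / r`:
`T_{x,r}[μ](B) = μ (x + r B)`. (It is set to zero for `r ≤ 0`.) -/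
def dilate (μ : LocalCharge d l) (x : RSpace d) (r : ℝ) : LocalCharge d l where
  toFun B := open Classical in
    if 0 < r ∧ MeasurableSet B ∧ Bornology.IsBounded B then
      μ ((fun z => r⁻¹ • (z - x)) ⁻¹' B) else 0
  eq_zero' B hB := if_neg fun h => hB h.2
  hasSum' f hf hd hb := by
    have hm : Measurable (fun z : RSpace d => r⁻¹ • (z - x)) := by fun_prop
    have hbi : ∀ i, Bornology.IsBounded (f i) := fun i => hb.subset (Set.subset_iUnion f i)
    by_cases hr : 0 < r
    · simp only [hr, hf, hbi, hb, MeasurableSet.iUnion hf, and_self, if_true]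
      rw [Set.preimage_iUnion]
      refine μ.hasSum' _ (fun i => hm (hf i)) (fun i j hij => (hd hij).preimage _) ?_
      obtain ⟨R, hR⟩ := hb.exists_norm_le
      rw [← Set.preimage_iUnion]
      refine (Metric.isBounded_closedBall (x := x) (r := r * R)).subset fun z hz => ?_
      have h := hR _ hz
      rw [norm_smul, norm_inv, Real.norm_of_nonneg hr.le, inv_mul_le_iff₀ hr] at h
      simpa [dist_eq_norm] using h
    · simp [hr, hasSum_zero]

/-- The charge `a ⊗ ν`, `(a ⊗ ν)(B) = ν(B) a`, where `ν` is a locally finite measure. -/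
def tensor (a : CSpace l) (ν : Measure (RSpace d)) [IsLocallyFiniteMeasure ν] :
    LocalCharge d l where
  toFun B := open Classical in
    if MeasurableSet B ∧ Bornology.IsBounded B then ν.real B • a else 0
  eq_zero' B hB := if_neg hB
  hasSum' f hf hd hb := by
    have hbi : ∀ i, Bornology.IsBounded (f i) := fun i => hb.subset (Set.subset_iUnion f i)
    simp only [hf, hbi, hb, MeasurableSet.iUnion hf, and_self, if_true]
    refine HasSum.smul_const ?_ a
    have hfin : ν (⋃ i, f i) ≠ ∞ := hb.measure_lt_top.ne
    simp only [Measure.real]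
    rw [measure_iUnion hd hf] at hfin ⊢
    rw [ENNReal.tsum_toReal_eq (fun i => (hbi i).measure_lt_top.ne)]
    exact (ENNReal.summable_toReal hfin).hasSum

/-- Classical convergence of locally finite charges: convergence of the integrals of all
continuous compactly supported functions. -/
def Converges (m : ℕ → LocalCharge d l) (m₀ : LocalCharge d l) : Prop :=
  ∀ f : RSpace d → ℂ, Continuous f → HasCompactSupport f →
    Tendsto (fun j => (m j).integral f) atTop (𝓝 (m₀.integral f))

/-- The tangent cone `Tan[μ, x]`: all non-zero locally finite charges that are limits of
`c_j T_{x,r_j}[μ]` for some `c_j > 0` and `r_j ↘ 0`. -/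
def tangentCone (μ : LocalCharge d l) (x : RSpace d) : Set (LocalCharge d l) :=
  {m | m ≠ 0 ∧ ∃ c r : ℕ → ℝ, (∀ j, 0 < c j) ∧ (∀ j, 0 < r j) ∧ StrictAnti r ∧
    Tendsto r atTop (𝓝 0) ∧ Converges (fun j => c j • μ.dilate x (r j)) m}

/-- The tempered distribution `u ∈ 𝓢'(ℝ^d, ℂ^l)` is the charge `μ`: the two agree on the (dense)
set of smooth compactly supported functions. The relation `μ ∈ 𝓢'(ℝ^d, ℂ^l)` means that there is
such a `u`, which is then unique. -/
def IsDistribution (μ : LocalCharge d l) (u : 𝓢'(RSpace d, CSpace l)) : Prop :=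
  ∀ φ : 𝓢(RSpace d, ℂ), HasCompactSupport φ → u φ = μ.integral φ

end LocalCharge

/-- The local lower Hausdorff dimension `liminf_{r → 0+} log ν(B_r(x)) / log r` of a measure at a
point `x` of its support; `B_r(x)` is a closed ball. -/
def localLowerDimH {d : ℕ} (ν : Measure (RSpace d)) (x : RSpace d) : EReal :=
  liminf (fun r : ℝ => ENNReal.log (ν (Metric.closedBall x r)) / ((Real.log r : ℝ) : EReal))
    (𝓝[>] 0)

/-- A measure is tempered if its balls of radius `R ≥ 1` about the origin have polynomially
bounded measure (in particular, it is locally finite). -/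
def IsTempered {d : ℕ} (ν : Measure (RSpace d)) : Prop :=
  ∃ (N : ℕ) (C : ℝ≥0), ∀ R : ℝ, 1 ≤ R →
    ν (Metric.closedBall 0 R) ≤ C * ENNReal.ofReal R ^ N

/-- The Schwartz function `z ↦ φ ((z - x) / r)`, `r > 0` (and zero for `r ≤ 0`). -/
def schwartzRescale {d : ℕ} (x : RSpace d) (r : ℝ) : 𝓢(RSpace d, ℂ) →L[ℂ] 𝓢(RSpace d, ℂ) :=
  if hr : 0 < r then
    (SchwartzMap.compSubConstCLM ℂ x).comp (SchwartzMap.compCLMOfContinuousLinearEquiv ℂ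
      (ContinuousLinearEquiv.smulLeft (R₁ := ℝ) (M₁ := RSpace d)
        (Units.mk0 r⁻¹ (inv_ne_zero hr.ne'))))
  else 0

theorem schwartzRescale_apply {d : ℕ} (x : RSpace d) {r : ℝ} (hr : 0 < r) (φ : 𝓢(RSpace d, ℂ))
    (z : RSpace d) : schwartzRescale x r φ z = φ (r⁻¹ • (z - x)) := by
  simp [schwartzRescale, hr, Units.smul_def]

/-- The dilation `T_{x,r}[u]` of a tempered distribution, defined by duality so that it extends
the dilation of charges: `⟨T_{x,r}[u], φ⟩ = ⟨u, φ ((· - x) / r)⟩`. -/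
def distributionDilate {d l : ℕ} (u : 𝓢'(RSpace d, CSpace l)) (x : RSpace d) (r : ℝ)
    (φ : 𝓢(RSpace d, ℂ)) : CSpace l :=
  u (schwartzRescale x r φ)

/-- `a ⊗ ν` is tangent at `x`, in the Schwartz sense, to the charge given by the tempered
distribution `u`: `c_j T_{x,r_j}[u] → a ⊗ ν` in `𝓢'` for some `c_j > 0` and `r_j ↘ 0`. -/
def IsSchwartzTangent {d l : ℕ} (u : 𝓢'(RSpace d, CSpace l)) (x : RSpace d)
    (a : CSpace l) (ν : Measure (RSpace d)) : Prop :=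
  ∃ c r : ℕ → ℝ, (∀ j, 0 < c j) ∧ (∀ j, 0 < r j) ∧ StrictAnti r ∧ Tendsto r atTop (𝓝 0) ∧
    ∀ φ : 𝓢(RSpace d, ℂ), Tendsto (fun j => c j • distributionDilate u x (r j) φ) atTop
      (𝓝 ((∫ z, φ z ∂ν) • a))

end

/-! On a bounded set the charge has an integrable density `g` with respect to a finite measure `κ`.
At a Lebesgue point `x` of `g` with `g x ≠ 0` a blow-up freezes the direction: limits have the form
`a ⊗ ν` with `a = g x` and `ν` a limit of rescalings of `κ`. The point and the scales have to be
chosen so that `ν` exists, is tempered and has small dimension at 0.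

The point. Take `F` with `μ F ≠ 0` and `dimH F < β`, where `β` is slightly above the dimension of
`μ`. The points of `F` with `κ(B_r) ≤ r^β` for all small `r` form a `κ`-null set, because there `κ`
is dominated by the `β`-dimensional Hausdorff measure, which vanishes on `F`. So `F` contains a
Lebesgue point with `g x ≠ 0` and `κ(B_r(x)) > r^β` for arbitrarily small `r` (`exists_good_point`).

The scales. The sequence `a n = -log₂ κ(B_{2^{-n}}(x))` is monotone and `a m ≤ β m + β` for
infinitely many `m`. A discrete rising sun lemma (`mul_card_filter_steep_le`) shows that at most `(a
m - a 0)/N` indices up to `m` see a backward average slope above `N`; by reflection at most `(a m -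
a 0)/γ` see a forward one above `γ`. If `β (1/N + 1/γ) < 1`, good indices remain
(`exists_moderate_index`). At a good scale `r`, the backward bound gives growth of degree `N` of the
rescaled measure, and the forward bound gives `κ(B_{2^{-k} r}) ≥ 2^{-γ k} κ(B_r)`, which survives in
the limit and bounds the dimension by `γ > β`.

The limit. The weight `(1 + ‖z‖)^{-(N+2)}` turns uniform polynomial growth into tightness, so
Prokhorov's theorem yields `ν`, with convergence for all test functions of that decay, Schwartz
functions included (`exists_tempered_limit`, `exists_blowup`). The part of a tempered distribution
away from `x` contributes `O(r^L)` for every `L`, which beats `c_j ≤ K r_j^{-N}`. -/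

/-! ### Densities of vector measures and charges -/

theorem exists_finite_measure_withDensity {X E : Type*} [MeasurableSpace X]
    [NormedAddCommGroup E] [NormedSpace ℝ E] [FiniteDimensional ℝ E] (V : VectorMeasure X E) :
    ∃ (κ : Measure X) (_ : IsFiniteMeasure κ) (g : X → E), Integrable g κ ∧
      V = κ.withDensityᵥ g := by
  classical
  let b := Module.finBasis ℝ E
  let s : Fin (Module.finrank ℝ E) → SignedMeasure X := fun i =>
    V.mapRange (b.coord i).toAddMonoidHom (LinearMap.continuous_of_finiteDimensional (b.coord i))
  -- This measure dominates every coordinate, so Radon–Nikodym applies to each of them.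
  let κ : Measure X := ∑ i, (s i).totalVariation
  have hac : ∀ i, s i ≪ᵥ κ.toENNRealVectorMeasure := by
    intro i
    refine VectorMeasure.AbsolutelyContinuous.mk fun B hB h0 => ?_
    rw [Measure.toENNRealVectorMeasure_apply_measurable hB] at h0
    have h1 : (s i).totalVariation B ≤ κ B := by
      simp only [κ, Measure.finsetSum_apply]
      exact Finset.single_le_sum (f := fun i => (s i).totalVariation B) (fun _ _ => zero_le)
        (Finset.mem_univ i)
    have h2 := (s i).enorm_le_totalVariation B
    simpa using le_antisymm (h2.trans (h1.trans h0.le)) zero_le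
  have hd : ∀ i, κ.withDensityᵥ ((s i).rnDeriv κ) = s i := fun i =>
    (s i).withDensityᵥ_rnDeriv_eq κ (hac i)
  have hint : ∀ i, Integrable ((s i).rnDeriv κ) κ := fun i => (s i).integrable_rnDeriv κ
  have hg : Integrable (fun x => ∑ i, (s i).rnDeriv κ x • b i) κ :=
    integrable_finsetSum _ fun i _ => (hint i).smul_const (b i)
  refine ⟨κ, inferInstance, fun x => ∑ i, (s i).rnDeriv κ x • b i, hg, ?_⟩
  ext B hB
  rw [withDensityᵥ_apply hg hB, integral_finsetSum _ fun i _ =>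
    ((hint i).smul_const (b i)).integrableOn]
  simp_rw [integral_smul_const, ← withDensityᵥ_apply (hint _) hB, hd]
  exact (b.sum_repr (V B)).symm

/-- The variation is `‖g‖ κ`, and both sides are continuous in `f` for its `L¹` norm, so it is
enough to compare them on indicators. -/
theorem integral_withDensityᵥ_eq {X E F G : Type*} [MeasurableSpace X]
    [NormedAddCommGroup E] [NormedSpace ℝ E] [NormedAddCommGroup F] [NormedSpace ℝ F]
    [CompleteSpace F] [NormedAddCommGroup G] [NormedSpace ℝ G] [CompleteSpace G]
    (B : E →L[ℝ] F →L[ℝ] G) {κ : Measure X} {g : X → F} (hg : Integrable g κ) {f : X → E}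
    (hf : (κ.withDensityᵥ g).Integrable f) :
    (κ.withDensityᵥ g).integral f B = ∫ x, B (f x) (g x) ∂κ := by
  have hvar := κ.variation_withDensityᵥ hg
  have hgm : AEMeasurable (fun x => ‖g x‖ₑ) κ := hg.1.enorm
  have hlt : ∀ᵐ x ∂κ, ‖g x‖ₑ < ∞ := Eventually.of_forall fun x => enorm_lt_top
  have hfin : IsFiniteMeasure (κ.withDensityᵥ g).variation := by
    rw [hvar]; exact isFiniteMeasure_withDensity hg.2.ne
  -- Null sets of the variation are blind to `{g = 0}`, but there `B (f x) (g x)` vanishes anyway.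
  have hae : ∀ {f₁ f₂ : X → E}, f₁ =ᵐ[(κ.withDensityᵥ g).variation] f₂ →
      (fun x => B (f₁ x) (g x)) =ᵐ[κ] fun x => B (f₂ x) (g x) := by
    intro f₁ f₂ h
    rw [hvar] at h
    have h' := (ae_withDensity_iff' hgm).1 h
    filter_upwards [h'] with x hx
    by_cases h0 : g x = 0
    · simp [h0]
    · rw [hx (by simpa using h0)]
  have hB : ∀ {f : X → E}, (κ.withDensityᵥ g).Integrable f →
      Integrable (fun x => B (f x) (g x)) κ ∧
      ∫ x, ‖B (f x) (g x)‖ ∂κ ≤ ‖B‖ * ∫ x, ‖f x‖ ∂(κ.withDensityᵥ g).variation := by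
    intro f hf
    have hi : Integrable (fun x => ‖g x‖ * ‖f x‖) κ := by
      have h := hf.norm
      rw [hvar, integrable_withDensity_iff_integrable_smul₀' hgm hlt] at h
      simpa using h
    have heq : ∫ x, ‖f x‖ ∂(κ.withDensityᵥ g).variation = ∫ x, ‖g x‖ * ‖f x‖ ∂κ := by
      rw [hvar, integral_withDensity_eq_integral_toReal_smul₀ hgm hlt]
      simp
    have hle : ∀ x, ‖B (f x) (g x)‖ ≤ ‖B‖ * (‖g x‖ * ‖f x‖) := fun x => by
      rw [mul_comm ‖g x‖, ← mul_assoc]; exact B.le_opNorm₂ _ _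
    have hm : AEStronglyMeasurable (fun x => B (f x) (g x)) κ := by
      have h1 : (fun x => B (f x) (g x)) =ᵐ[κ] fun x => B (hf.1.mk f x) (g x) :=
        hae hf.1.ae_eq_mk
      refine AEStronglyMeasurable.congr ?_ h1.symm
      exact B.aestronglyMeasurable_comp₂ hf.1.stronglyMeasurable_mk.aestronglyMeasurable hg.1
    refine ⟨(hi.const_mul ‖B‖).mono' hm (Eventually.of_forall hle), ?_⟩
    rw [heq, ← integral_const_mul]
    exact integral_mono_of_nonneg (Eventually.of_forall fun x => norm_nonneg _)
      (hi.const_mul _) (Eventually.of_forall hle)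
  refine Integrable.induction (P := fun f => (κ.withDensityᵥ g).integral f B =
    ∫ x, B (f x) (g x) ∂κ) ?_ ?_ ?_ ?_ hf
  · intro c s hs _
    have h1 : (fun x => B (s.indicator (fun _ => c) x) (g x)) =
        s.indicator (fun x => B c (g x)) := by
      ext x; by_cases hx : x ∈ s <;> simp [hx]
    rw [h1, integral_indicator hs, (B c).integral_comp_comm hg.integrableOn,
      VectorMeasure.integral_indicator_const _ hs, withDensityᵥ_apply hg hs]
  · intro f₁ f₂ _ hf₁ hf₂ h₁ h₂
    simp only [Pi.add_apply, map_add, add_apply]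
    rw [integral_add (hB hf₁).1 (hB hf₂).1, ← h₁, ← h₂]
    exact VectorMeasure.integral_fun_add hf₁ hf₂
  · have hc : Continuous fun f : X →₁[(κ.withDensityᵥ g).variation] E =>
        ∫ x, B (f x) (g x) ∂κ := by
      refine (LipschitzWith.of_dist_le_mul (K := ‖B‖₊) fun f₁ f₂ => ?_).continuous
      rw [dist_eq_norm, ← integral_sub (hB (L1.integrable_coeFn f₁)).1
        (hB (L1.integrable_coeFn f₂)).1]
      refine (norm_integral_le_integral_norm _).trans ?_
      have h := (hB ((L1.integrable_coeFn f₁).sub (L1.integrable_coeFn f₂))).2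
      simp only [Pi.sub_apply, map_sub, sub_apply] at h
      refine h.trans_eq ?_
      rw [dist_eq_norm, L1.norm_sub_eq_lintegral]
      congr 1
      exact integral_norm_eq_lintegral_enorm
        ((L1.integrable_coeFn f₁).sub (L1.integrable_coeFn f₂)).1
    exact isClosed_eq VectorMeasure.continuous_integral hc
  · intro f₁ f₂ h12 _ h
    rw [← VectorMeasure.integral_congr_ae h12, h]
    exact integral_congr_ae (hae h12)

namespace LocalCharge

variable {d l : ℕ}

theorem integral_eq_of_density (m : LocalCharge d l) {f : RSpace d → ℂ} (hf : Continuous f)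
    (hc : HasCompactSupport f) {κ : Measure (RSpace d)} {G : RSpace d → CSpace l}
    (hG : IntegrableOn G (tsupport f) κ)
    (h : ∀ B, MeasurableSet B → B ⊆ tsupport f → m B = ∫ x in B, G x ∂κ) :
    m.integral f = ∫ x, f x • G x ∂κ := by
  have hK : MeasurableSet (tsupport f) := (isClosed_tsupport f).measurableSet
  have hKb : Bornology.IsBounded (tsupport f) := hc.isCompact.isBounded
  have hG' : Integrable ((tsupport f).indicator G) κ := (integrable_indicator_iff hK).2 hG
  have hV : m.restrict (tsupport f) = κ.withDensityᵥ ((tsupport f).indicator G) := by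
    ext1 B hB
    rw [withDensityᵥ_apply hG' hB, setIntegral_indicator hK,
      ← h _ (hB.inter hK) Set.inter_subset_right]
    exact if_pos ⟨hB, hK, hKb⟩
  have hfin : IsFiniteMeasure (κ.withDensityᵥ ((tsupport f).indicator G)).variation := by
    rw [κ.variation_withDensityᵥ hG']; exact isFiniteMeasure_withDensity hG'.2.ne
  rw [LocalCharge.integral, hV, integral_withDensityᵥ_eq _ hG']
  · refine integral_congr_ae (Eventually.of_forall fun x => ?_)
    by_cases hx : x ∈ tsupport f
    · simp [hx]
    · simp [image_eq_zero_of_notMem_tsupport hx]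
  · obtain ⟨C, hC⟩ := hf.bounded_above_of_compact_support hc
    exact Integrable.of_bound hf.aestronglyMeasurable C (Eventually.of_forall hC)

theorem enorm_le_variation (m : LocalCharge d l) {B : Set (RSpace d)} (hB : MeasurableSet B) :
    ‖m B‖ₑ ≤ m.variation B := by
  by_cases hB' : (⟨B, hB⟩ : Subtype MeasurableSet) = ⊥
  · obtain rfl : B = ∅ := congrArg Subtype.val hB'
    simp [m.apply_empty]
  simp only [variation, preVariation, VectorMeasure.ennrealToMeasure_apply hB, ennrealPreVariation_apply]
  calc
    ‖m B‖ₑ = ∑ p ∈ (Finpartition.indiscrete hB').parts, ‖m p‖ₑ := by simp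
    _ ≤ preVariationFun (‖m ·‖ₑ) B := by apply preVariation.sum_le

end LocalCharge

/-! ### Counting good scales -/

/-- Discrete rising sun lemma. If `m` is steep with witness `k`, the block `(m - k, m]` holds at
most `k` steep indices while `a` rises by more than `N k` across it, so the block can be removed. If
`m` is not steep, drop it and use monotonicity. -/
theorem mul_card_filter_steep_le {a : ℕ → ℝ} (ha : Monotone a) {N : ℝ} (hN : 0 ≤ N) (m : ℕ) :
    N * (((Finset.range (m + 1)).filter fun n => ∃ k ≤ n, N * k < a n - a (n - k)).card : ℝ)
      ≤ a m - a 0 := by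
  induction m using Nat.strong_induction_on with
  | _ m ih =>
    set p : ℕ → Prop := fun n => ∃ k ≤ n, N * k < a n - a (n - k) with hp
    by_cases hm : p m
    · obtain ⟨k, hk, hlt⟩ := hm
      have hk0 : k ≠ 0 := by rintro rfl; simp at hlt
      have h1 := ih (m - k) (by omega)
      have hsub : (Finset.range (m + 1)).filter p ⊆
          (Finset.range (m - k + 1)).filter p ∪ Finset.Ioc (m - k) m := by
        intro n hn
        simp only [Finset.mem_filter, Finset.mem_range, Finset.mem_union, Finset.mem_Ioc] at hn ⊢
        by_cases h : n < m - k + 1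
        · exact Or.inl ⟨h, hn.2⟩
        · exact Or.inr ⟨by omega, by omega⟩
      have hc := (Finset.card_le_card hsub).trans (Finset.card_union_le _ _)
      rw [Nat.card_Ioc, Nat.sub_sub_self hk] at hc
      have hc' : (((Finset.range (m + 1)).filter p).card : ℝ) ≤
          ((Finset.range (m - k + 1)).filter p).card + k := by exact_mod_cast hc
      calc N * (((Finset.range (m + 1)).filter p).card : ℝ)
          ≤ N * (((Finset.range (m - k + 1)).filter p).card + k) := by gcongr
        _ ≤ a m - a 0 := by rw [mul_add]; linarith
    · rcases m with _ | m
      · have : (Finset.range (0 + 1)).filter p = ∅ := by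
          ext n
          simp only [Finset.mem_filter, Finset.mem_range, Finset.notMem_empty, iff_false, not_and]
          intro hn
          obtain rfl : n = 0 := by omega
          exact hm
        rw [this]; simp
      · rw [Finset.range_add_one, Finset.filter_insert, if_neg hm]
        exact (ih m (by omega)).trans (by linarith [ha (Nat.le_succ m)])

/-- Otherwise the two kinds of steep indices, apart from `2 J` boundary ones, would fill `0, …, m`,
although they number at most `(a m - a 0)(1/N + 1/γ)`, which is a proportion below 1 of `m` up to a
constant. -/
theorem exists_moderate_index {a : ℕ → ℝ} (ha : Monotone a) {β N γ C : ℝ} (hN : 0 < N)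
    (hγ : 0 < γ) (hβ : 0 < β) (hlt : 1 / N + 1 / γ < 1 / β)
    (hfreq : ∃ᶠ m : ℕ in atTop, a m ≤ β * m + C) (J : ℕ) :
    ∃ n ≥ J, (∀ k ≤ n, a n - a (n - k) ≤ N * k) ∧ ∀ k ≤ J, a (n + k) - a n ≤ γ * k := by
  by_contra! hcon
  set θ : ℝ := 1 - β * (1 / N + 1 / γ) with hθ
  have hθ0 : 0 < θ := by
    have := mul_lt_mul_of_pos_left hlt hβ
    rw [mul_one_div_cancel hβ.ne'] at this
    linarith
  obtain ⟨m, hm, hmC⟩ := ((hfreq.and_eventually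
    (eventually_gt_atTop ⌈(2 * J + (C - a 0) * (1 / N + 1 / γ)) / θ⌉₊))).exists
  have hmbig : 2 * J + (C - a 0) * (1 / N + 1 / γ) < θ * m := by
    have := Nat.lt_of_ceil_lt hmC
    rw [div_lt_iff₀ hθ0] at this
    linarith
  let U := (Finset.range (m + 1)).filter fun n => ∃ k ≤ n, N * k < a n - a (n - k)
  -- Reflection turns forward slopes of `a` into backward slopes of `a'`.
  let a' : ℕ → ℝ := fun i => - a (m - i)
  have ha' : Monotone a' := fun i j hij => neg_le_neg (ha (by omega))
  let V := (Finset.range (m + 1)).filter fun n => ∃ k ≤ n, γ * k < a' n - a' (n - k)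
  have hU : N * (U.card : ℝ) ≤ a m - a 0 := mul_card_filter_steep_le ha hN.le m
  have hV : γ * (V.card : ℝ) ≤ a m - a 0 := by
    have := mul_card_filter_steep_le ha' hγ.le m
    simp only [a', Nat.sub_self, Nat.sub_zero] at this
    linarith
  -- The last `J` indices are set aside so that `n + k ≤ m` for all `k ≤ J`, as the reflection
  -- requires.
  have hcov : Finset.range (m + 1) ⊆
      Finset.range J ∪ Finset.Ioc (m - J) m ∪ U ∪ V.image (fun i => m - i) := by
    intro n hn
    simp only [Finset.mem_range, Finset.mem_union, Finset.mem_Ioc, Finset.mem_image, U, V,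
      Finset.mem_filter] at hn ⊢
    by_cases h1 : n < J
    · exact Or.inl (Or.inl (Or.inl h1))
    by_cases h2 : m - J < n
    · exact Or.inl (Or.inl (Or.inr ⟨h2, by omega⟩))
    by_cases h3 : ∃ k ≤ n, N * k < a n - a (n - k)
    · exact Or.inl (Or.inr ⟨hn, h3⟩)
    push Not at h3
    obtain ⟨k, hk, hlt'⟩ := hcon n (by omega) h3
    refine Or.inr ⟨m - n, ⟨by omega, k, by omega, ?_⟩, by omega⟩
    simp only [a']
    rw [show m - (m - n) = n by omega, show m - (m - n - k) = n + k by omega]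
    linarith
  have hcard := (Finset.card_le_card hcov).trans ((Finset.card_union_le _ _).trans
    (Nat.add_le_add ((Finset.card_union_le _ _).trans
      (Nat.add_le_add_right (Finset.card_union_le _ _) _)) Finset.card_image_le))
  simp only [Finset.card_range, Nat.card_Ioc] at hcard
  have hcard' : (m : ℝ) + 1 ≤ J + J + U.card + V.card := by
    have : m + 1 ≤ J + J + U.card + V.card := by omega
    exact_mod_cast this
  have hU' : (U.card : ℝ) ≤ (a m - a 0) * (1 / N) := by
    rw [mul_one_div, le_div_iff₀ hN]; linarith
  have hV' : (V.card : ℝ) ≤ (a m - a 0) * (1 / γ) := by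
    rw [mul_one_div, le_div_iff₀ hγ]; linarith
  have hq : 0 ≤ 1 / N + 1 / γ := by positivity
  have h3 : (a m - a 0) * (1 / N + 1 / γ) ≤ (β * m + C - a 0) * (1 / N + 1 / γ) := by
    gcongr
  rw [hθ] at hmbig
  nlinarith

theorem exists_scales {h : ℝ → ℝ} (hmono : Monotone h) (hpos : ∀ r, 0 < r → 0 < h r) {M : ℝ}
    (hM : ∀ r, h r ≤ M) {β γ : ℝ} (hβ : 0 < β) (hβγ : β < γ)
    (hfreq : ∃ᶠ r in 𝓝[>] (0 : ℝ), r ^ β < h r) :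
    ∃ (N : ℕ) (C : ℝ) (r : ℕ → ℝ), 0 < C ∧ (∀ j, 0 < r j) ∧ StrictAnti r ∧
      Tendsto r atTop (𝓝 0) ∧ (∀ j, r j ≤ 1) ∧
      (∀ j : ℕ, ∀ R ≥ 1, h (R * r j) ≤ C * R ^ N * h (r j)) ∧
      ∀ j : ℕ, ∀ k ≤ j, (2 : ℝ) ^ (-(γ * k)) * h (r j) ≤ h ((2 : ℝ) ^ (-(k : ℝ)) * r j) := by
  have hρ : ∀ n : ℕ, 0 < (2 : ℝ) ^ (-(n : ℝ)) := fun n => by positivity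
  let a : ℕ → ℝ := fun n => - Real.logb 2 (h ((2 : ℝ) ^ (-(n : ℝ))))
  have hha : ∀ n : ℕ, h ((2 : ℝ) ^ (-(n : ℝ))) = 2 ^ (- a n) := fun n => by
    simp only [a, neg_neg]
    rw [Real.rpow_logb (by norm_num) (by norm_num) (hpos _ (hρ n))]
  have ha : Monotone a := by
    intro i j hij
    simp only [a]
    refine neg_le_neg (Real.logb_le_logb_of_le (by norm_num) (hpos _ (hρ j)) (hmono ?_))
    exact Real.rpow_le_rpow_of_exponent_le (by norm_num) (by simpa using hij)
  have hγ : 0 < γ := hβ.trans hβγ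
  obtain ⟨N, hN⟩ := exists_nat_gt (1 / (1 / β - 1 / γ))
  have hdiff : 0 < 1 / β - 1 / γ := sub_pos.2 (one_div_lt_one_div_of_lt hβ hβγ)
  have hN0 : (0 : ℝ) < N := (one_div_pos.2 hdiff).trans hN
  have hlt : 1 / (N : ℝ) + 1 / γ < 1 / β := by
    have := (one_div_lt hdiff hN0).1 hN
    linarith
  have hfr : ∃ᶠ m : ℕ in atTop, a m ≤ β * m + β := by
    rw [frequently_atTop]
    intro J
    have hev : ∀ᶠ r in 𝓝[>] (0 : ℝ), r ∈ Set.Ioo 0 ((2 : ℝ) ^ (-(J : ℝ))) :=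
      Ioo_mem_nhdsGT (hρ J)
    obtain ⟨r, hr, hr0, hrJ⟩ := (hfreq.and_eventually hev).exists
    have hr1 : -Real.logb 2 r ≥ J := by
      have := Real.logb_lt_logb (b := 2) (by norm_num) hr0 hrJ
      rw [Real.logb_rpow (by norm_num) (by norm_num)] at this
      linarith
    -- Rounding `r` up to the dyadic scale `2^{-m}` costs at most one unit of `m`, hence the
    -- additive constant `β`.
    refine ⟨⌊-Real.logb 2 r⌋₊, Nat.le_floor hr1, ?_⟩
    set m := ⌊-Real.logb 2 r⌋₊
    have hm1 : (m : ℝ) ≤ -Real.logb 2 r := Nat.floor_le ((Nat.cast_nonneg J).trans hr1)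
    have hm2 : -Real.logb 2 r < m + 1 := Nat.lt_floor_add_one _
    have hle : r ≤ (2 : ℝ) ^ (-(m : ℝ)) := by
      rw [← Real.logb_le_iff_le_rpow (by norm_num) hr0]; linarith
    have h2 : r ^ β < h ((2 : ℝ) ^ (-(m : ℝ))) := hr.trans_le (hmono hle)
    have h3 := Real.logb_lt_logb (b := 2) (by norm_num) (by positivity) h2
    rw [Real.logb_rpow_eq_mul_logb_of_pos hr0] at h3
    simp only [a]
    nlinarith
  have hgood := exists_moderate_index ha hN0 hγ hβ hlt hfr
  choose n hnJ hup hdown using hgood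
  obtain ⟨φ, hφ, hφn⟩ : ∃ φ : ℕ → ℕ, StrictMono φ ∧ StrictMono (n ∘ φ) :=
    strictMono_subseq_of_id_le hnJ
  have h1 : 0 < h 1 := hpos 1 one_pos
  have hM0 : 0 < M := h1.trans_le (hM 1)
  have htwo : StrictAnti fun x : ℝ => (2 : ℝ) ^ (-x) := fun x y hxy =>
    Real.rpow_lt_rpow_of_exponent_lt (by norm_num) (by linarith)
  -- The factor `2 ^ N` pays for rounding `R` up to a power of 2. The slope bound only reaches up to
  -- scale 1; beyond it `h ≤ M`, which accounts for `M / h 1`.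
  refine ⟨N, max (2 ^ N) (M / h 1), fun j => (2 : ℝ) ^ (-((n (φ j) : ℕ) : ℝ)),
    lt_max_of_lt_left (by positivity), fun j => hρ _, fun i j hij => ?_, ?_, fun j => ?_, ?_, ?_⟩
  · exact htwo (by exact_mod_cast hφn hij)
  · have h2 : Tendsto (fun x : ℝ => (2 : ℝ) ^ (-x)) atTop (𝓝 0) := by
      exact tendsto_rpow_atBot_of_base_gt_one 2 one_lt_two |>.comp tendsto_neg_atTop_atBot
    exact h2.comp (tendsto_natCast_atTop_atTop.comp hφn.tendsto_atTop)
  · exact Real.rpow_le_one_of_one_le_of_nonpos (by norm_num) (by simp)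
  · intro j R hR
    set i := n (φ j)
    have hR0 : 0 < R := one_pos.trans_le hR
    have key : ∀ k ≤ i, h ((2 : ℝ) ^ (k : ℝ) * 2 ^ (-(i : ℝ))) ≤
        ((2 : ℝ) ^ (k : ℝ)) ^ N * h (2 ^ (-(i : ℝ))) := by
      intro k hk
      have e1 : (2 : ℝ) ^ (k : ℝ) * 2 ^ (-(i : ℝ)) = 2 ^ (-((i - k : ℕ) : ℝ)) := by
        rw [← Real.rpow_add (by norm_num)]; congr 1; push_cast [hk]; ring
      rw [e1, hha, hha, ← Real.rpow_mul_natCast (by norm_num), ← Real.rpow_add (by norm_num)]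
      refine Real.rpow_le_rpow_of_exponent_le (by norm_num) ?_
      have := hup (φ j) k hk
      linarith
    have hRlog : 0 ≤ Real.logb 2 R := Real.logb_nonneg (by norm_num) hR
    set k := ⌈Real.logb 2 R⌉₊
    have hk1 : R ≤ 2 ^ (k : ℝ) := by
      rw [← Real.logb_le_iff_le_rpow (by norm_num) hR0]; exact Nat.le_ceil _
    have hk2 : (2 : ℝ) ^ (k : ℝ) ≤ 2 * R := by
      have : (k : ℝ) ≤ 1 + Real.logb 2 R := by linarith [Nat.ceil_lt_add_one hRlog]
      calc (2 : ℝ) ^ (k : ℝ) ≤ 2 ^ (1 + Real.logb 2 R) :=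
            Real.rpow_le_rpow_of_exponent_le (by norm_num) this
        _ = 2 * R := by
            rw [Real.rpow_add (by norm_num), Real.rpow_one,
              Real.rpow_logb (by norm_num) (by norm_num) hR0]
    by_cases hki : k ≤ i
    · calc h (R * 2 ^ (-(i : ℝ))) ≤ h ((2 : ℝ) ^ (k : ℝ) * 2 ^ (-(i : ℝ))) :=
            hmono (by gcongr)
        _ ≤ ((2 : ℝ) ^ (k : ℝ)) ^ N * h (2 ^ (-(i : ℝ))) := key k hki
        _ ≤ (2 * R) ^ N * h (2 ^ (-(i : ℝ))) := by
            have := (hpos _ (hρ i)).le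
            gcongr
        _ ≤ max (2 ^ N) (M / h 1) * R ^ N * h (2 ^ (-(i : ℝ))) := by
            have := (hpos _ (hρ i)).le
            rw [mul_pow]
            gcongr
            exact le_max_left _ _
    · have hiR : (2 : ℝ) ^ (i : ℝ) ≤ R := by
        by_contra hcon
        push Not at hcon
        refine hki (Nat.ceil_le.2 ?_)
        rw [Real.logb_le_iff_le_rpow (by norm_num) hR0]; exact hcon.le
      have e := key i le_rfl
      rw [← Real.rpow_add (by norm_num), add_neg_cancel, Real.rpow_zero] at e
      calc h (R * 2 ^ (-(i : ℝ))) ≤ M := hM _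
        _ = M / h 1 * h 1 := by field_simp
        _ ≤ M / h 1 * (((2 : ℝ) ^ (i : ℝ)) ^ N * h (2 ^ (-(i : ℝ)))) := by gcongr
        _ ≤ M / h 1 * (R ^ N * h (2 ^ (-(i : ℝ)))) := by
            have := (hpos _ (hρ i)).le
            gcongr
        _ ≤ max (2 ^ N) (M / h 1) * R ^ N * h (2 ^ (-(i : ℝ))) := by
            have := (hpos _ (hρ i)).le
            rw [← mul_assoc]
            gcongr
            exact le_max_right _ _
  · intro j k hk
    set i := n (φ j)
    have := hdown (φ j) k (hk.trans (hφ.id_le j))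
    rw [← Real.rpow_add (by norm_num), show -(k : ℝ) + -(i : ℝ) = -((i + k : ℕ) : ℝ) by
      push_cast; ring, hha, hha, ← Real.rpow_add (by norm_num)]
    refine Real.rpow_le_rpow_of_exponent_le (by norm_num) ?_
    linarith

/-! ### Choice of the point -/

/-- Mass distribution principle: on the exceptional set `E n` a set of small diameter has `κ`-mass
at most its diameter to the power `β`. Thus `κ` restricted to `E n` lies below `μH[β]`, which is
zero on `F`. -/
theorem ae_frequently_rpow_lt_measure_closedBall {X : Type*} [MetricSpace X]
    [MeasurableSpace X] [BorelSpace X] (κ : Measure X) {F : Set X}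
    (hF : MeasurableSet F) {β : ℝ≥0} (hβ : dimH F < β) :
    ∀ᵐ x ∂κ, x ∈ F → ∃ᶠ r in 𝓝[>] (0 : ℝ),
      ENNReal.ofReal r ^ (β : ℝ) < κ (Metric.closedBall x r) := by
  let E : ℕ → Set X := fun n => {x ∈ F | ∀ r ∈ Set.Ioo (0 : ℝ) (1 / (n + 1)),
    κ (Metric.closedBall x r) ≤ ENNReal.ofReal r ^ (β : ℝ)}
  have hE : ∀ n, κ (E n) = 0 := by
    intro n
    have hle : κ.restrict (E n) ≤ μH[(β : ℝ)] := by
      have hn : (0 : ℝ) < 1 / (n + 1) := by positivity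
      refine Measure.le_hausdorffMeasure _ _ (ENNReal.ofReal (1 / (n + 1) / 2))
        (ENNReal.ofReal_pos.2 (half_pos hn)) ?_
      intro s hs
      have h1 : κ.restrict (E n) s ≤ κ.restrict (E n) (closure s) := measure_mono subset_closure
      rw [Measure.restrict_apply isClosed_closure.measurableSet] at h1
      refine h1.trans ?_
      rcases (closure s ∩ E n).eq_empty_or_nonempty with h0 | ⟨x, hxs, hxF, hx⟩
      · simp [h0]
      have hfin : Metric.ediam s ≠ ∞ := ne_top_of_le_ne_top ENNReal.ofReal_ne_top hs
      set δ := (Metric.ediam s).toReal with hδ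
      have hδ' : Metric.ediam s = ENNReal.ofReal δ := (ENNReal.ofReal_toReal hfin).symm
      have hδlt : δ < 1 / (n + 1) := by
        have h2 := ENNReal.toReal_le_of_le_ofReal (by positivity) hs
        linarith
      have hsub : closure s ⊆ Metric.closedBall x δ := by
        intro y hy
        have h2 := Metric.edist_le_ediam_of_mem hy hxs
        rw [Metric.ediam_closure, hδ', edist_dist] at h2
        exact (ENNReal.ofReal_le_ofReal_iff ENNReal.toReal_nonneg).1 h2
      refine (measure_mono (Set.inter_subset_left.trans hsub)).trans ?_
      -- The diameter `δ` may be 0, where the bound from `E n` is not available, so radii decreasing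
      -- to `δ` are used.
      have hlim : Tendsto (fun r : ℝ => ENNReal.ofReal r ^ (β : ℝ)) (𝓝[>] δ)
          (𝓝 (ENNReal.ofReal δ ^ (β : ℝ))) :=
        ((ENNReal.continuous_rpow_const.comp ENNReal.continuous_ofReal).tendsto δ).mono_left
          nhdsWithin_le_nhds
      rw [hδ']
      refine ge_of_tendsto hlim ?_
      filter_upwards [Ioo_mem_nhdsGT hδlt] with r hr
      exact (measure_mono (Metric.closedBall_subset_closedBall hr.1.le)).trans
        (hx r ⟨ENNReal.toReal_nonneg.trans_lt hr.1, hr.2⟩)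
    have h0 : μH[(β : ℝ)] F = 0 := hausdorffMeasure_of_dimH_lt hβ
    have h1 := hle F
    rw [h0, Measure.restrict_apply hF, Set.inter_eq_right.2 fun x hx => hx.1] at h1
    exact le_antisymm h1 zero_le
  have hae : ∀ᵐ x ∂κ, ∀ n, x ∉ E n := ae_all_iff.2 fun n => measure_eq_zero_iff_ae_notMem.1 (hE n)
  filter_upwards [hae] with x hx hxF
  by_contra hcon
  rw [not_frequently] at hcon
  obtain ⟨u, hu, hsub⟩ := mem_nhdsGT_iff_exists_Ioo_subset.1 hcon
  obtain ⟨n, hn⟩ := exists_nat_one_div_lt (show (0 : ℝ) < u from hu)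
  exact hx n ⟨hxF, fun r hr => not_lt.1 (hsub ⟨hr.1, hr.2.trans hn⟩)⟩

theorem exists_good_point {d l : ℕ} (κ : Measure (RSpace d)) [IsFiniteMeasure κ]
    {g : RSpace d → CSpace l} (hg : Integrable g κ) {F : Set (RSpace d)} (hF : MeasurableSet F)
    {β : ℝ≥0} (hβ : dimH F < β) (h0 : ∫ x in F, g x ∂κ ≠ 0) :
    ∃ x ∈ F, g x ≠ 0 ∧ (∀ r > 0, 0 < κ (Metric.closedBall x r)) ∧
      Tendsto (fun r => (∫⁻ y in Metric.closedBall x r, ‖g y - g x‖ₑ ∂κ) /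
        κ (Metric.closedBall x r)) (𝓝[>] 0) (𝓝 0) ∧
      ∃ᶠ r in 𝓝[>] (0 : ℝ), ENNReal.ofReal r ^ (β : ℝ) < κ (Metric.closedBall x r) := by
  have h1 := ae_frequently_rpow_lt_measure_closedBall κ hF hβ
  have h2 := (Besicovitch.vitaliFamily κ).ae_tendsto_lintegral_enorm_sub_div_of_integrable hg
  have h3 : ∃ᶠ x in ae κ, x ∈ F ∧ g x ≠ 0 := by
    intro hcon
    refine h0 (setIntegral_eq_zero_of_ae_eq_zero ?_)
    filter_upwards [hcon] with x hx hxF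
    by_contra h
    exact hx ⟨hxF, h⟩
  obtain ⟨x, ⟨hxF, hgx⟩, hx1, hx2⟩ := (h3.and_eventually (h1.and h2)).exists
  refine ⟨x, hxF, hgx, fun r hr => ?_, hx2.comp (Besicovitch.tendsto_filterAt κ x), hx1 hxF⟩
  obtain ⟨s, hs, hsr⟩ := ((hx1 hxF).and_eventually (Ioo_mem_nhdsGT hr)).exists
  exact (zero_le.trans_lt hs).trans_le
    (measure_mono (Metric.closedBall_subset_closedBall hsr.2.le))

/-- A vanishing integral would force the mean of `‖g - g x‖` over the ball to be at least `‖g x‖`.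
This puts `x` in the support of the charge. -/
theorem eventually_setIntegral_closedBall_ne_zero {d l : ℕ} (κ : Measure (RSpace d))
    [IsFiniteMeasure κ] {g : RSpace d → CSpace l} (hg : Integrable g κ) {x : RSpace d}
    (hgx : g x ≠ 0) (hpos : ∀ r > 0, 0 < κ (Metric.closedBall x r))
    (hlim : Tendsto (fun r => (∫⁻ y in Metric.closedBall x r, ‖g y - g x‖ₑ ∂κ) /
        κ (Metric.closedBall x r)) (𝓝[>] 0) (𝓝 0)) :
    ∀ᶠ r in 𝓝[>] (0 : ℝ), ∫ y in Metric.closedBall x r, g y ∂κ ≠ 0 := by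
  have h0 : 0 < ‖g x‖ₑ := by simpa using hgx
  filter_upwards [hlim.eventually_lt_const h0, self_mem_nhdsWithin] with r hr hr0 hcon
  rw [ENNReal.div_lt_iff (Or.inl (hpos r hr0).ne') (Or.inl (measure_ne_top _ _))] at hr
  have h1 : ∫ y in Metric.closedBall x r, (g y - g x) ∂κ =
      - (κ.real (Metric.closedBall x r) • g x) := by
    rw [integral_sub hg.integrableOn (integrable_const _), hcon, setIntegral_const, zero_sub]
  have h2 := enorm_integral_le_lintegral_enorm (μ := κ.restrict (Metric.closedBall x r))
    fun y => g y - g x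
  rw [h1, enorm_neg, enorm_smul, Measure.real, Real.enorm_of_nonneg ENNReal.toReal_nonneg,
    ENNReal.ofReal_toReal (measure_ne_top _ _), mul_comm] at h2
  exact (h2.trans_lt hr).false

/-! ### Weighted integrals under polynomial growth -/

/-- The weight `(1 + ‖z‖)⁻ⁿ`. -/
noncomputable def decayWeight {d : ℕ} (n : ℕ) (z : RSpace d) : ℝ := ((1 + ‖z‖) ^ n)⁻¹

section decayWeight

variable {d : ℕ}

theorem decayWeight_pos (n : ℕ) (z : RSpace d) : 0 < decayWeight n z := by
  unfold decayWeight; positivity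

theorem decayWeight_le_one (n : ℕ) (z : RSpace d) : decayWeight n z ≤ 1 :=
  inv_le_one_of_one_le₀ (one_le_pow₀ (by linarith [norm_nonneg z]))

theorem continuous_decayWeight (n : ℕ) : Continuous (decayWeight n : RSpace d → ℝ) := by
  unfold decayWeight
  exact Continuous.inv₀ (by fun_prop) fun z => by positivity

theorem le_decayWeight (n : ℕ) {z : RSpace d} (hz : ‖z‖ ≤ 1) :
    ((2 : ℝ) ^ n)⁻¹ ≤ decayWeight n z := by
  unfold decayWeight
  gcongr
  linarith

/-- Dyadic decomposition: one power beyond the growth exponent leaves a geometric series. -/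
theorem lintegral_decayWeight_le (m : Measure (RSpace d)) {N : ℕ} {M : ℝ≥0∞}
    (h : ∀ R : ℝ, 1 ≤ R → m (Metric.closedBall 0 R) ≤ M * ENNReal.ofReal R ^ N) :
    ∫⁻ z, ENNReal.ofReal (decayWeight (N + 1) z) ∂m ≤ 2 ^ (N + 2) * M := by
  let c : ℕ → ℝ := fun k => 2 ^ (N + 1) * (((2 : ℝ) ^ k) ^ (N + 1))⁻¹
  have hpt : ∀ z : RSpace d, ENNReal.ofReal (decayWeight (N + 1) z) ≤
      ∑' k : ℕ, (Metric.closedBall (0 : RSpace d) (2 ^ k)).indicator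
        (fun _ => ENNReal.ofReal (c k)) z := by
    intro z
    obtain ⟨k, hk1, hk2⟩ := exists_nat_pow_near (x := 1 + ‖z‖) (y := 2)
      (by linarith [norm_nonneg z]) (by norm_num)
    refine le_trans ?_ (ENNReal.le_tsum (k + 1))
    rw [Set.indicator_of_mem (by simp; linarith)]
    refine ENNReal.ofReal_le_ofReal ?_
    have hck : c (k + 1) = (((2 : ℝ) ^ k) ^ (N + 1))⁻¹ := by
      simp only [c]
      rw [pow_succ 2 k, mul_pow]
      field_simp
    rw [hck, decayWeight]
    gcongr
  have hc : ∀ k, ENNReal.ofReal (c k) * ENNReal.ofReal (2 ^ k) ^ N =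
      2 ^ (N + 1) * (2 : ℝ≥0∞)⁻¹ ^ k := by
    intro k
    rw [← ENNReal.ofReal_pow (by positivity), ← ENNReal.ofReal_mul (by positivity),
      ← ENNReal.ofReal_ofNat, ← ENNReal.ofReal_inv_of_pos (by positivity),
      ← ENNReal.ofReal_pow (by positivity), ← ENNReal.ofReal_pow (by positivity),
      ← ENNReal.ofReal_mul (by positivity)]
    congr 1
    simp only [c, inv_pow]
    field_simp
    ring
  calc ∫⁻ z, ENNReal.ofReal (decayWeight (N + 1) z) ∂m
      ≤ ∫⁻ z, ∑' k : ℕ, (Metric.closedBall (0 : RSpace d) (2 ^ k)).indicator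
        (fun _ => ENNReal.ofReal (c k)) z ∂m := lintegral_mono hpt
    _ = ∑' k : ℕ, ENNReal.ofReal (c k) * m (Metric.closedBall 0 (2 ^ k)) := by
        rw [lintegral_tsum fun k => (measurable_const.indicator
          Metric.isClosed_closedBall.measurableSet).aemeasurable]
        congr 1; ext k
        rw [lintegral_indicator_const Metric.isClosed_closedBall.measurableSet]
    _ ≤ ∑' k : ℕ, 2 ^ (N + 1) * M * (2 : ℝ≥0∞)⁻¹ ^ k := by
        refine ENNReal.tsum_le_tsum fun k => ?_
        calc ENNReal.ofReal (c k) * m (Metric.closedBall 0 (2 ^ k))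
            ≤ ENNReal.ofReal (c k) * (M * ENNReal.ofReal (2 ^ k) ^ N) := by
              gcongr
              exact h _ (one_le_pow₀ (by norm_num))
          _ = M * (ENNReal.ofReal (c k) * ENNReal.ofReal (2 ^ k) ^ N) := by ring
          _ = 2 ^ (N + 1) * M * (2 : ℝ≥0∞)⁻¹ ^ k := by rw [hc]; ring
    _ = 2 ^ (N + 2) * M := by
        rw [ENNReal.tsum_mul_left, ENNReal.tsum_geometric, ENNReal.one_sub_inv_two, inv_inv]
        ring

/-- The second extra power is spent on a tail of order `1/R`, which makes the weighted measures
uniformly tight. -/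
theorem setLIntegral_compl_closedBall_decayWeight_le (m : Measure (RSpace d)) {N : ℕ} {M : ℝ≥0∞}
    (h : ∀ R : ℝ, 1 ≤ R → m (Metric.closedBall 0 R) ≤ M * ENNReal.ofReal R ^ N) {R : ℝ}
    (hR : 0 < R) :
    ∫⁻ z in (Metric.closedBall 0 R)ᶜ, ENNReal.ofReal (decayWeight (N + 2) z) ∂m ≤
      ENNReal.ofReal R⁻¹ * (2 ^ (N + 2) * M) := by
  calc ∫⁻ z in (Metric.closedBall 0 R)ᶜ, ENNReal.ofReal (decayWeight (N + 2) z) ∂m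
      ≤ ∫⁻ z in (Metric.closedBall 0 R)ᶜ, ENNReal.ofReal R⁻¹ *
          ENNReal.ofReal (decayWeight (N + 1) z) ∂m := by
        refine setLIntegral_mono' Metric.isClosed_closedBall.measurableSet.compl fun z hz => ?_
        have hz' : R < ‖z‖ := by simpa using hz
        rw [← ENNReal.ofReal_mul (by positivity)]
        refine ENNReal.ofReal_le_ofReal ?_
        unfold decayWeight
        rw [show N + 2 = N + 1 + 1 by rfl, pow_succ, mul_inv_rev]
        gcongr
        linarith
    _ ≤ ENNReal.ofReal R⁻¹ * ∫⁻ z, ENNReal.ofReal (decayWeight (N + 1) z) ∂m := by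
        rw [lintegral_const_mul _ (continuous_decayWeight _).measurable.ennreal_ofReal]
        gcongr
        exact Measure.restrict_le_self
    _ ≤ ENNReal.ofReal R⁻¹ * (2 ^ (N + 2) * M) := by
        gcongr
        exact lintegral_decayWeight_le m h

theorem tendsto_ofReal_inv_mul {M : ℝ≥0∞} (hM : M ≠ ∞) :
    Tendsto (fun R : ℝ => ENNReal.ofReal R⁻¹ * M) atTop (𝓝 0) := by
  have h1 : Tendsto (fun R : ℝ => ENNReal.ofReal R⁻¹) atTop (𝓝 0) := by
    simpa [Function.comp_def] using
      (ENNReal.continuous_ofReal.tendsto 0).comp tendsto_inv_atTop_zero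
  simpa using ENNReal.Tendsto.mul_const h1 (Or.inr hM)

theorem tendsto_lintegral_decayWeight_zero {m : ℕ → Measure (RSpace d)} {N : ℕ} {M : ℝ≥0∞}
    (hM : M ≠ ∞)
    (h : ∀ j, ∀ R : ℝ, 1 ≤ R → m j (Metric.closedBall 0 R) ≤ M * ENNReal.ofReal R ^ N)
    (h0 : ∀ R : ℝ, 0 < R → Tendsto (fun j => m j (Metric.closedBall 0 R)) atTop (𝓝 0)) :
    Tendsto (fun j => ∫⁻ z, ENNReal.ofReal (decayWeight (N + 2) z) ∂m j) atTop (𝓝 0) := by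
  rw [ENNReal.tendsto_nhds_zero]
  intro ε hε
  have hε2 : 0 < ε / 2 := ENNReal.half_pos hε.ne'
  have hM' : 2 ^ (N + 2) * M ≠ ∞ := ENNReal.mul_ne_top (by finiteness) hM
  obtain ⟨R, hRε, hR⟩ := ((ENNReal.tendsto_nhds_zero.1 (tendsto_ofReal_inv_mul hM') _ hε2).and
    (eventually_gt_atTop 0)).exists
  filter_upwards [ENNReal.tendsto_nhds_zero.1 (h0 R hR) _ hε2] with j hj
  rw [← lintegral_add_compl _ (Metric.isClosed_closedBall (x := (0 : RSpace d))
    (ε := R)).measurableSet, ← ENNReal.add_halves ε]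
  refine add_le_add (le_trans ?_ hj)
    ((setLIntegral_compl_closedBall_decayWeight_le (m j) (h j) hR).trans hRε)
  calc ∫⁻ z in Metric.closedBall 0 R, ENNReal.ofReal (decayWeight (N + 2) z) ∂m j
      ≤ ∫⁻ z in Metric.closedBall 0 R, 1 ∂m j :=
        lintegral_mono fun z => ENNReal.ofReal_le_one.2 (decayWeight_le_one _ _)
    _ = m j (Metric.closedBall 0 R) := by simp

end decayWeight

/-! ### Compactness for measures of uniform polynomial growth -/

theorem isTempered_withDensity_decayWeight_inv {d : ℕ} (ρ : Measure (RSpace d))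
    [IsProbabilityMeasure ρ] (n : ℕ) :
    IsTempered (ρ.withDensity fun z => ENNReal.ofReal (decayWeight n z)⁻¹) := by
  refine ⟨n, 2 ^ n, fun R hR => ?_⟩
  rw [withDensity_apply _ Metric.isClosed_closedBall.measurableSet]
  calc ∫⁻ z in Metric.closedBall 0 R, ENNReal.ofReal (decayWeight n z)⁻¹ ∂ρ
      ≤ ∫⁻ z in Metric.closedBall 0 R, 2 ^ n * ENNReal.ofReal R ^ n ∂ρ := by
        refine setLIntegral_mono' Metric.isClosed_closedBall.measurableSet fun z hz => ?_
        have hz' : ‖z‖ ≤ R := by simpa using hz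
        rw [← mul_pow, ← ENNReal.ofReal_ofNat, ← ENNReal.ofReal_mul (by positivity),
          ← ENNReal.ofReal_pow (by positivity)]
        refine ENNReal.ofReal_le_ofReal ?_
        rw [decayWeight, inv_inv]
        gcongr
        linarith
    _ ≤ 2 ^ n * ENNReal.ofReal R ^ n := by
        rw [setLIntegral_const]
        exact mul_le_of_le_one_right' prob_le_one
    _ = _ := by push_cast; rfl

theorem IsTempered.isLocallyFiniteMeasure {d : ℕ} {ν : Measure (RSpace d)} (h : IsTempered ν) :
    IsLocallyFiniteMeasure ν := by
  obtain ⟨N, C, h⟩ := h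
  refine ⟨fun x => ⟨Metric.closedBall 0 (‖x‖ + 1), ?_, ?_⟩⟩
  · refine Filter.mem_of_superset (Metric.ball_mem_nhds x one_pos) fun y hy => ?_
    have h1 := norm_sub_norm_le y x
    rw [mem_ball_iff_norm] at hy
    simp only [mem_closedBall_zero_iff]
    linarith
  · exact (h _ (by linarith [norm_nonneg x])).trans_lt (by finiteness)

/-- Weighting and normalising gives tight probability measures; `ν` is a weak limit `Q` divided by
the weight. The normalisation `W j` is comparable to the mass of the unit ball, so relative lower
bounds on small closed balls pass to `ν` by the portmanteau theorem, up to the factor `D`. -/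
theorem exists_tempered_limit {d : ℕ} {κ : ℕ → Measure (RSpace d)} [∀ j, IsFiniteMeasure (κ j)]
    {N : ℕ} {C : ℝ≥0} (hpos : ∀ j, 0 < κ j (Metric.closedBall 0 1))
    (hgrow : ∀ j, ∀ R : ℝ, 1 ≤ R → κ j (Metric.closedBall 0 R) ≤
      C * κ j (Metric.closedBall 0 1) * ENNReal.ofReal R ^ N) :
    ∃ (c : ℕ → ℝ) (φ : ℕ → ℕ) (ν : Measure (RSpace d)), StrictMono φ ∧ IsTempered ν ∧
      (∀ j, 0 < c j) ∧
      (∀ j, ENNReal.ofReal (c j) * κ j (Metric.closedBall 0 1) ≤ 2 ^ (N + 2)) ∧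
      (∀ f : RSpace d → ℂ, Continuous f → (∃ B : ℝ, ∀ z, ‖f z‖ ≤ B * decayWeight (N + 2) z) →
        Tendsto (fun j => c (φ j) • ∫ z, f z ∂κ (φ j)) atTop (𝓝 (∫ z, f z ∂ν))) ∧
      ∃ D : ℝ≥0∞, D ≠ 0 ∧ ∀ (s : ℝ) (b : ℝ≥0∞), s ≤ 1 →
        (∀ᶠ j in atTop, b * κ j (Metric.closedBall 0 1) ≤ κ j (Metric.closedBall 0 s)) →
        D * b ≤ ν (Metric.closedBall 0 s) := by
  let w : RSpace d → ℝ≥0∞ := fun z => ENNReal.ofReal (decayWeight (N + 2) z)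
  have hw : Measurable w := (continuous_decayWeight _).measurable.ennreal_ofReal
  let W : ℕ → ℝ≥0∞ := fun j => ∫⁻ z, w z ∂κ j
  have hlow : ∀ j, ∀ s ≤ 1, (2 ^ (N + 2))⁻¹ * κ j (Metric.closedBall 0 s) ≤
      ∫⁻ z in Metric.closedBall 0 s, w z ∂κ j := by
    intro j s hs
    rw [← setLIntegral_const]
    refine setLIntegral_mono' Metric.isClosed_closedBall.measurableSet fun z hz => ?_
    have hz' : ‖z‖ ≤ 1 := (by simpa using hz : ‖z‖ ≤ s).trans hs
    have h2 := ENNReal.ofReal_le_ofReal (le_decayWeight (N + 2) hz')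
    rwa [ENNReal.ofReal_inv_of_pos (by positivity), ENNReal.ofReal_pow (by norm_num),
      ENNReal.ofReal_ofNat] at h2
  have hWlow : ∀ j, (2 ^ (N + 2))⁻¹ * κ j (Metric.closedBall 0 1) ≤ W j := fun j =>
    (hlow j 1 le_rfl).trans (setLIntegral_le_lintegral _ _)
  have hWup : ∀ j, W j ≤ 2 ^ (N + 2) * (C * κ j (Metric.closedBall 0 1)) := by
    intro j
    refine (lintegral_mono fun z => ENNReal.ofReal_le_ofReal ?_).trans
      (lintegral_decayWeight_le (κ j) (hgrow j))
    unfold decayWeight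
    gcongr
    · linarith [norm_nonneg z]
    · norm_num
  have hWpos : ∀ j, W j ≠ 0 := fun j => by
    refine (lt_of_lt_of_le ?_ (hWlow j)).ne'
    exact ENNReal.mul_pos (by simp) (hpos j).ne'
  have hWfin : ∀ j, W j ≠ ∞ := fun j => ne_top_of_le_ne_top (by finiteness) (hWup j)
  let ρ : ℕ → Measure (RSpace d) := fun j => (W j)⁻¹ • (κ j).withDensity w
  have hρ : ∀ j, IsProbabilityMeasure (ρ j) := fun j => ⟨by
    simp only [ρ, Measure.smul_apply, withDensity_apply _ MeasurableSet.univ,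
      Measure.restrict_univ, smul_eq_mul]
    exact ENNReal.inv_mul_cancel (hWpos j) (hWfin j)⟩
  let P : ℕ → ProbabilityMeasure (RSpace d) := fun j => ⟨ρ j, hρ j⟩
  let K : ℝ≥0∞ := 2 ^ (N + 2) * 2 ^ (N + 2) * C
  have hK : K ≠ ∞ := by finiteness
  have htight : IsTightMeasureSet {((μ : ProbabilityMeasure (RSpace d)) : Measure (RSpace d)) |
      μ ∈ Set.range P} := by
    refine isTightMeasureSet_of_tendsto_measure_compl_closedBall (x := 0) ?_
    refine tendsto_of_tendsto_of_tendsto_of_le_of_le' tendsto_const_nhds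
      (tendsto_ofReal_inv_mul hK) (Eventually.of_forall fun _ => zero_le) ?_
    filter_upwards [eventually_gt_atTop 0] with R hR
    refine iSup₂_le ?_
    rintro _ ⟨_, ⟨j, rfl⟩, rfl⟩
    change (ρ j) _ ≤ _
    simp only [ρ, Measure.smul_apply, smul_eq_mul]
    rw [withDensity_apply _ Metric.isClosed_closedBall.measurableSet.compl]
    rw [mul_comm, ← div_eq_mul_inv]
    refine ENNReal.div_le_of_le_mul ?_
    refine (setLIntegral_compl_closedBall_decayWeight_le (κ j) (hgrow j) hR).trans ?_
    calc ENNReal.ofReal R⁻¹ * (2 ^ (N + 2) * (C * κ j (Metric.closedBall 0 1)))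
        = ENNReal.ofReal R⁻¹ * K * ((2 ^ (N + 2))⁻¹ * κ j (Metric.closedBall 0 1)) := by
          simp only [K]
          have : (2 : ℝ≥0∞) ^ (N + 2) * (2 ^ (N + 2))⁻¹ = 1 :=
            ENNReal.mul_inv_cancel (by simp) (by finiteness)
          calc _ = ENNReal.ofReal R⁻¹ * (2 ^ (N + 2) * (C * κ j (Metric.closedBall 0 1))) *
              (2 ^ (N + 2) * (2 ^ (N + 2))⁻¹) := by rw [this, mul_one]
            _ = _ := by ring
      _ ≤ ENNReal.ofReal R⁻¹ * K * W j := by gcongr; exact hWlow j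
  obtain ⟨Q, -, φ, hφ, hlim⟩ := (isCompact_closure_of_isTightMeasureSet htight).tendsto_subseq
    (x := P) fun j => subset_closure ⟨j, rfl⟩
  have hv : Measurable fun z : RSpace d => ENNReal.ofReal (decayWeight (N + 2) z)⁻¹ :=
    (continuous_decayWeight _).measurable.inv.ennreal_ofReal
  refine ⟨fun j => (W j).toReal⁻¹, φ,
    (Q : Measure (RSpace d)).withDensity fun z => ENNReal.ofReal (decayWeight (N + 2) z)⁻¹, hφ,
    isTempered_withDensity_decayWeight_inv _ _,
    fun j => inv_pos.2 (ENNReal.toReal_pos (hWpos j) (hWfin j)), fun j => ?_, ?_,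
    (2 ^ (N + 2))⁻¹ * (2 ^ (N + 2) * (C : ℝ≥0∞))⁻¹, ?_, ?_⟩
  · simp only
    rw [← ENNReal.toReal_inv, ENNReal.ofReal_toReal (by simpa using hWpos j), mul_comm,
      ← div_eq_mul_inv]
    refine ENNReal.div_le_of_le_mul ?_
    have h1 := mul_le_mul_right (hWlow j) (2 ^ (N + 2))
    rwa [← mul_assoc, ENNReal.mul_inv_cancel (by simp) (by finiteness), one_mul] at h1
  · rintro f hf ⟨B, hB⟩
    -- Division by the weight makes `f` a bounded test function for the weak convergence.
    let F : BoundedContinuousFunction (RSpace d) ℂ := BoundedContinuousFunction.ofNormedAddCommGroup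
      (fun z => (decayWeight (N + 2) z)⁻¹ • f z)
      (((continuous_decayWeight _).inv₀ fun z => (decayWeight_pos _ z).ne').smul hf) B (by
        intro z
        rw [norm_smul, norm_inv, Real.norm_of_nonneg (decayWeight_pos _ z).le,
          inv_mul_le_iff₀ (decayWeight_pos _ z), mul_comm]
        exact hB z)
    have h1 := (ProbabilityMeasure.tendsto_iff_forall_integral_rclike_tendsto ℂ).1 hlim F
    rw [integral_withDensity_eq_integral_toReal_smul hv
      (Eventually.of_forall fun _ => ENNReal.ofReal_lt_top)]
    have e1 : ∫ z, (ENNReal.ofReal (decayWeight (N + 2) z)⁻¹).toReal • f z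
        ∂(Q : Measure (RSpace d)) = ∫ z, F z ∂(Q : Measure (RSpace d)) := by
      refine integral_congr_ae (Eventually.of_forall fun z => ?_)
      simp only
      rw [ENNReal.toReal_ofReal (inv_nonneg.2 (decayWeight_pos _ z).le)]
      rfl
    rw [e1]
    refine h1.congr fun j => ?_
    change ∫ z, F z ∂(ρ (φ j)) = _
    simp only [ρ]
    rw [integral_smul_measure, integral_withDensity_eq_integral_toReal_smul hw
      (Eventually.of_forall fun _ => ENNReal.ofReal_lt_top), ENNReal.toReal_inv]
    congr 1
    refine integral_congr_ae (Eventually.of_forall fun z => ?_)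
    simp only [w]
    rw [ENNReal.toReal_ofReal (decayWeight_pos _ z).le]
    exact smul_inv_smul₀ (decayWeight_pos _ z).ne' (f z)
  · have h1 : (2 : ℝ≥0∞) ^ (N + 2) * C ≠ ∞ := by finiteness
    simp only [ne_eq, mul_eq_zero, ENNReal.inv_eq_zero, not_or]
    exact ⟨by finiteness, h1⟩
  · intro s b hs hev
    have h1 := ProbabilityMeasure.limsup_measure_closed_le_of_tendsto hlim
      (Metric.isClosed_closedBall (x := (0 : RSpace d)) (ε := s))
    have h2 : (Q : Measure (RSpace d)) (Metric.closedBall 0 s) ≤ ((Q : Measure (RSpace d)).withDensity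
        fun z => ENNReal.ofReal (decayWeight (N + 2) z)⁻¹) (Metric.closedBall 0 s) := by
      rw [withDensity_apply _ Metric.isClosed_closedBall.measurableSet, ← setLIntegral_one]
      refine lintegral_mono fun z => ?_
      rw [ENNReal.one_le_ofReal]
      exact (one_le_inv₀ (decayWeight_pos _ z)).2 (decayWeight_le_one _ z)
    refine le_trans ?_ (h1.trans h2)
    refine le_limsup_of_frequently_le' (Eventually.frequently ?_)
    filter_upwards [hφ.tendsto_atTop.eventually hev] with j hj
    change _ ≤ (ρ (φ j)) _
    simp only [ρ, Measure.smul_apply, smul_eq_mul]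
    rw [withDensity_apply _ Metric.isClosed_closedBall.measurableSet]
    set i := φ j
    calc (2 ^ (N + 2))⁻¹ * (2 ^ (N + 2) * (C : ℝ≥0∞))⁻¹ * b
        = (2 ^ (N + 2) * (C : ℝ≥0∞))⁻¹ * (2 ^ (N + 2))⁻¹ * b *
            ((κ i (Metric.closedBall 0 1))⁻¹ * κ i (Metric.closedBall 0 1)) := by
          rw [ENNReal.inv_mul_cancel (hpos i).ne' (measure_ne_top _ _)]; ring
      _ = ((2 ^ (N + 2) * (C : ℝ≥0∞))⁻¹ * (κ i (Metric.closedBall 0 1))⁻¹) *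
            ((2 ^ (N + 2))⁻¹ * (b * κ i (Metric.closedBall 0 1))) := by ring
      _ = (2 ^ (N + 2) * (C * κ i (Metric.closedBall 0 1)))⁻¹ *
            ((2 ^ (N + 2))⁻¹ * (b * κ i (Metric.closedBall 0 1))) := by
          rw [← mul_assoc _ (C : ℝ≥0∞), ENNReal.mul_inv (Or.inr (measure_ne_top _ _)) (Or.inr (hpos i).ne')]
      _ ≤ (W i)⁻¹ * ((2 ^ (N + 2))⁻¹ * κ i (Metric.closedBall 0 s)) := by
          gcongr
          exact hWup i
      _ ≤ (W i)⁻¹ * ∫⁻ z in Metric.closedBall 0 s, w z ∂κ i := by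
          gcongr
          exact hlow i s hs

/-! ### Rescaled Schwartz functions away from the centre -/

section schwartzRescale

variable {d : ℕ}

theorem norm_iteratedFDeriv_schwartzRescale (x : RSpace d) {r : ℝ} (hr : 0 < r)
    (φ : 𝓢(RSpace d, ℂ)) (m : ℕ) (z : RSpace d) :
    ‖iteratedFDeriv ℝ m (schwartzRescale x r φ) z‖ =
      r⁻¹ ^ m * ‖iteratedFDeriv ℝ m φ (r⁻¹ • (z - x))‖ := by
  have h1 : (schwartzRescale x r φ : RSpace d → ℂ) = fun z => (fun y => φ (r⁻¹ • y)) (z - x) :=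
    funext fun z => schwartzRescale_apply x hr φ z
  rw [h1, iteratedFDeriv_comp_sub (f := fun y => φ (r⁻¹ • y)), iteratedFDeriv_comp_const_smul _ (φ.smooth m), norm_smul,
    norm_pow, norm_inv, Real.norm_of_nonneg hr.le]

/-- Multiply by `(‖z - x‖ / δ) ^ (L + n) ≥ 1` and write `‖z - x‖ = r ‖y‖`: the powers of `r` absorb
the `r⁻¹ ^ m` from differentiation and still leave `r ^ L`. -/
theorem pow_mul_norm_iteratedFDeriv_schwartzRescale_le (x : RSpace d) {r : ℝ} (hr : 0 < r)
    (hr1 : r ≤ 1) {δ : ℝ} (hδ : 0 < δ) (φ : 𝓢(RSpace d, ℂ)) {K L m n : ℕ} (hmn : m ≤ n)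
    {z : RSpace d} (hz : δ ≤ ‖z - x‖) :
    ‖z - x‖ ^ K * ‖iteratedFDeriv ℝ m (schwartzRescale x r φ) z‖ ≤
      (δ ^ (L + n))⁻¹ * SchwartzMap.seminorm ℂ (K + (L + n)) m φ * r ^ L := by
  rw [norm_iteratedFDeriv_schwartzRescale x hr]
  set y := r⁻¹ • (z - x) with hy
  set D := ‖iteratedFDeriv ℝ m φ y‖
  have ht : ‖z - x‖ = r * ‖y‖ := by
    rw [hy, norm_smul, norm_inv, Real.norm_of_nonneg hr.le, mul_inv_cancel_left₀ hr.ne']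
  have hone : 1 ≤ (δ ^ (L + n))⁻¹ * ‖z - x‖ ^ (L + n) := by
    rw [← inv_pow, ← mul_pow]
    refine one_le_pow₀ ?_
    rw [inv_mul_eq_div, one_le_div hδ]
    exact hz
  have hsem := SchwartzMap.le_seminorm ℂ (K + (L + n)) m φ y
  calc ‖z - x‖ ^ K * (r⁻¹ ^ m * D)
      ≤ ‖z - x‖ ^ K * (r⁻¹ ^ m * D) * ((δ ^ (L + n))⁻¹ * ‖z - x‖ ^ (L + n)) :=
        le_mul_of_one_le_right (by positivity) hone
    _ = (δ ^ (L + n))⁻¹ * (‖y‖ ^ (K + (L + n)) * D) * (r ^ (K + (n - m)) * r ^ L) := by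
        have h2 : r ^ (K + (L + n)) * r⁻¹ ^ m = r ^ (K + (n - m)) * r ^ L := by
          rw [← pow_add, inv_pow, mul_inv_eq_iff_eq_mul₀ (by positivity), ← pow_add]
          congr 1
          omega
        rw [← h2, ht, mul_pow, mul_pow]
        ring
    _ ≤ (δ ^ (L + n))⁻¹ * SchwartzMap.seminorm ℂ (K + (L + n)) m φ * (1 * r ^ L) := by
        gcongr
        exact pow_le_one₀ hr.le hr1
    _ = _ := by rw [one_mul]

theorem seminorm_smulLeftCLM_schwartzRescale_le {η : RSpace d → ℂ}
    (hη : η.HasTemperateGrowth) {x : RSpace d} {δ : ℝ} (hδ : 0 < δ)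
    (h0 : ∀ z ∈ Metric.ball x δ, η z = 0) (φ : 𝓢(RSpace d, ℂ)) (k n L : ℕ) :
    ∃ C : ℝ, 0 ≤ C ∧ ∀ r, 0 < r → r ≤ 1 → SchwartzMap.seminorm ℂ k n
      (SchwartzMap.smulLeftCLM ℂ η (schwartzRescale x r φ)) ≤ C * r ^ L := by
  obtain ⟨k₀, C₀, hC₀, hbound⟩ := hη.norm_iteratedFDeriv_le_uniform n
  -- Chosen so that `1 + ‖z‖ ≤ A ‖z - x‖` off the ball of radius `δ`.
  set A : ℝ := (1 + ‖x‖) / δ + 1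
  have hA : 0 ≤ A := by positivity
  refine ⟨∑ i ∈ Finset.range (n + 1), (n.choose i : ℝ) * C₀ * A ^ (k + k₀) *
    ((δ ^ (L + n))⁻¹ * SchwartzMap.seminorm ℂ (k + k₀ + (L + n)) (n - i) φ),
    Finset.sum_nonneg fun i _ => by positivity, fun r hr hr1 => ?_⟩
  refine SchwartzMap.seminorm_le_bound ℂ k n _ (mul_nonneg
    (Finset.sum_nonneg fun i _ => by positivity) (by positivity)) fun z => ?_
  rw [SchwartzMap.smulLeftCLM_apply hη]
  by_cases hz : z ∈ Metric.ball x δ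
  · have h1 : (fun z => η z • schwartzRescale x r φ z) =ᶠ[𝓝 z] fun _ => 0 := by
      filter_upwards [Metric.isOpen_ball.mem_nhds hz] with y hy
      simp [h0 y hy]
    rw [(Filter.EventuallyEq.iteratedFDeriv ℝ h1 n).eq_of_nhds]
    have h2 : iteratedFDeriv ℝ n (fun _ : RSpace d => (0 : ℂ)) z = 0 := by
      simp
    rw [h2, norm_zero, mul_zero]
    exact mul_nonneg (Finset.sum_nonneg fun i _ => by positivity) (by positivity)
  · have hz' : δ ≤ ‖z - x‖ := by simpa [dist_eq_norm] using hz
    have hzA : 1 + ‖z‖ ≤ A * ‖z - x‖ := by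
      have h1 : ‖z‖ ≤ ‖x‖ + ‖z - x‖ := by simpa using norm_add_le x (z - x)
      have h2 : 1 + ‖x‖ ≤ (1 + ‖x‖) / δ * ‖z - x‖ := by
        rw [div_mul_eq_mul_div, le_div_iff₀ hδ]
        gcongr
      simp only [A, add_mul, one_mul]
      linarith
    have hleib := norm_iteratedFDeriv_smul_le (𝕜 := ℝ) (N := (n : ℕ))
      (hη.1.of_le (by exact_mod_cast le_top)) ((schwartzRescale x r φ).smooth n) z le_rfl
    calc ‖z‖ ^ k * ‖iteratedFDeriv ℝ n (fun z => η z • schwartzRescale x r φ z) z‖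
        ≤ ‖z‖ ^ k * ∑ i ∈ Finset.range (n + 1), (n.choose i : ℝ) * ‖iteratedFDeriv ℝ i η z‖ *
          ‖iteratedFDeriv ℝ (n - i) (schwartzRescale x r φ) z‖ := by gcongr
      _ = ∑ i ∈ Finset.range (n + 1), ‖z‖ ^ k * ((n.choose i : ℝ) * ‖iteratedFDeriv ℝ i η z‖ *
          ‖iteratedFDeriv ℝ (n - i) (schwartzRescale x r φ) z‖) := Finset.mul_sum _ _ _
      _ ≤ ∑ i ∈ Finset.range (n + 1), (n.choose i : ℝ) * C₀ * A ^ (k + k₀) *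
          ((δ ^ (L + n))⁻¹ * SchwartzMap.seminorm ℂ (k + k₀ + (L + n)) (n - i) φ) * r ^ L := by
          refine Finset.sum_le_sum fun i hi => ?_
          have hi' : i ≤ n := Nat.lt_succ_iff.1 (Finset.mem_range.1 hi)
          have h3 := pow_mul_norm_iteratedFDeriv_schwartzRescale_le x hr hr1 hδ φ
            (K := k + k₀) (L := L) (Nat.sub_le n i) hz'
          set D := ‖iteratedFDeriv ℝ (n - i) (schwartzRescale x r φ) z‖
          have h4 : ‖z‖ ^ k * (1 + ‖z‖) ^ k₀ ≤ A ^ (k + k₀) * ‖z - x‖ ^ (k + k₀) := by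
            rw [← mul_pow, pow_add]
            gcongr
            linarith [norm_nonneg z]
          calc ‖z‖ ^ k * ((n.choose i : ℝ) * ‖iteratedFDeriv ℝ i η z‖ * D)
              ≤ ‖z‖ ^ k * ((n.choose i : ℝ) * (C₀ * (1 + ‖z‖) ^ k₀) * D) := by
                gcongr
                exact hbound i hi' z
            _ = (n.choose i : ℝ) * C₀ * (‖z‖ ^ k * (1 + ‖z‖) ^ k₀) * D := by ring
            _ ≤ (n.choose i : ℝ) * C₀ * (A ^ (k + k₀) * ‖z - x‖ ^ (k + k₀)) * D := by gcongr
            _ = (n.choose i : ℝ) * C₀ * A ^ (k + k₀) * (‖z - x‖ ^ (k + k₀) * D) := by ring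
            _ ≤ (n.choose i : ℝ) * C₀ * A ^ (k + k₀) * ((δ ^ (L + n))⁻¹ *
                SchwartzMap.seminorm ℂ (k + k₀ + (L + n)) (n - i) φ * r ^ L) := by gcongr
            _ = _ := by ring
      _ = _ := (Finset.sum_mul _ _ _).symm

theorem exists_norm_smulLeftCLM_schwartzRescale_le {l : ℕ} (u : 𝓢'(RSpace d, CSpace l))
    {η : RSpace d → ℂ} (hη : η.HasTemperateGrowth) {x : RSpace d} {δ : ℝ} (hδ : 0 < δ)
    (h0 : ∀ z ∈ Metric.ball x δ, η z = 0) (φ : 𝓢(RSpace d, ℂ)) (L : ℕ) :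
    ∃ C : ℝ, ∀ r, 0 < r → r ≤ 1 →
      ‖u (SchwartzMap.smulLeftCLM ℂ η (schwartzRescale x r φ))‖ ≤ C * r ^ L := by
  obtain ⟨s, C, -, hC⟩ := Seminorm.bound_of_continuous (schwartz_withSeminorms ℂ (RSpace d) ℂ)
    ((normSeminorm ℂ (CSpace l)).comp u.toLinearMap) (continuous_norm.comp u.cont)
  choose B hB0 hB using fun p : ℕ × ℕ =>
    seminorm_smulLeftCLM_schwartzRescale_le hη hδ h0 φ p.1 p.2 L
  refine ⟨C * ∑ p ∈ s, B p, fun r hr hr1 => ?_⟩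
  set ψ := SchwartzMap.smulLeftCLM ℂ η (schwartzRescale x r φ)
  have h1 : ‖u ψ‖ ≤ C * (s.sup (schwartzSeminormFamily ℂ (RSpace d) ℂ)) ψ := hC ψ
  refine h1.trans ?_
  rw [mul_assoc]
  gcongr
  refine Seminorm.finset_sup_apply_le (by
    have := Finset.sum_nonneg fun p (_ : p ∈ s) => hB0 p
    positivity) fun p hp => (hB p r hr hr1).trans ?_
  gcongr
  exact Finset.single_le_sum (f := B) (fun p _ => hB0 p) hp

end schwartzRescale

/-! ### Blow-up at the good point -/

theorem preimage_rescale_closedBall {d : ℕ} (x : RSpace d) {r : ℝ} (hr : 0 < r) (R : ℝ) :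
    (fun z => r⁻¹ • (z - x)) ⁻¹' Metric.closedBall 0 R = Metric.closedBall x (R * r) := by
  ext z
  rw [Set.mem_preimage, mem_closedBall_zero_iff, mem_closedBall_iff_norm, norm_smul, norm_inv,
    Real.norm_of_nonneg hr.le, inv_mul_le_iff₀ hr, mul_comm]

/-- Small radii are covered by the limit, the others by comparing total mass with a fixed ball. The
bound at all radii lets the error measure inherit the growth of `κ`. -/
theorem exists_measure_mul_bound_of_tendsto_div {d : ℕ} {κ τ : Measure (RSpace d)}
    [IsFiniteMeasure κ] [IsFiniteMeasure τ] {x : RSpace d}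
    (hpos : ∀ r > 0, 0 < κ (Metric.closedBall x r))
    (hlim : Tendsto (fun r => τ (Metric.closedBall x r) / κ (Metric.closedBall x r))
      (𝓝[>] 0) (𝓝 0)) :
    ∃ E : ℝ≥0∞, E ≠ ∞ ∧ ∀ r > 0, τ (Metric.closedBall x r) ≤ E * κ (Metric.closedBall x r) := by
  obtain ⟨s, hs, hsub⟩ := mem_nhdsGT_iff_exists_Ioo_subset.1 (hlim.eventually_lt_const one_pos)
  have hs : (0 : ℝ) < s := hs
  refine ⟨1 + τ Set.univ / κ (Metric.closedBall x (s / 2)), ?_, fun r hr => ?_⟩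
  · refine ENNReal.add_ne_top.2 ⟨ENNReal.one_ne_top, ENNReal.div_ne_top (measure_ne_top _ _) ?_⟩
    exact (hpos _ (half_pos hs)).ne'
  · rcases lt_or_ge r s with h | h
    · have h1 : τ (Metric.closedBall x r) / κ (Metric.closedBall x r) < 1 := hsub ⟨hr, h⟩
      rw [ENNReal.div_lt_iff (Or.inl (hpos r hr).ne') (Or.inl (measure_ne_top _ _))] at h1
      exact h1.le.trans (by gcongr; exact le_self_add)
    · have h0 := (hpos _ (half_pos hs)).ne'
      calc τ (Metric.closedBall x r) ≤ τ Set.univ := measure_mono (Set.subset_univ _)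
        _ = τ Set.univ / κ (Metric.closedBall x (s / 2)) * κ (Metric.closedBall x (s / 2)) :=
            (ENNReal.div_mul_cancel h0 (measure_ne_top _ _)).symm
        _ ≤ (1 + τ Set.univ / κ (Metric.closedBall x (s / 2))) * κ (Metric.closedBall x r) := by
            gcongr
            · exact le_add_self
            · linarith

theorem exists_blowup {d l : ℕ} (κ : Measure (RSpace d)) [IsFiniteMeasure κ]
    {g : RSpace d → CSpace l} (hg : Integrable g κ) {x : RSpace d}
    (hpos : ∀ r > 0, 0 < κ (Metric.closedBall x r))
    (hlim : Tendsto (fun r => (∫⁻ y in Metric.closedBall x r, ‖g y - g x‖ₑ ∂κ) /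
      κ (Metric.closedBall x r)) (𝓝[>] 0) (𝓝 0))
    {β : ℝ≥0} {γ : ℝ} (hβ : 0 < β) (hβγ : β < γ)
    (hfreq : ∃ᶠ r in 𝓝[>] (0 : ℝ), ENNReal.ofReal r ^ (β : ℝ) < κ (Metric.closedBall x r)) :
    ∃ (c r : ℕ → ℝ) (N : ℕ) (K : ℝ) (ν : Measure (RSpace d)), (∀ j, 0 < c j) ∧ (∀ j, 0 < r j) ∧
      (∀ j, r j ≤ 1) ∧ StrictAnti r ∧ Tendsto r atTop (𝓝 0) ∧ (∀ j, c j * r j ^ N ≤ K) ∧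
      IsTempered ν ∧
      (∃ D : ℝ≥0∞, D ≠ 0 ∧ ∀ k : ℕ, D * ENNReal.ofReal (2 ^ (-(γ * k))) ≤
        ν (Metric.closedBall 0 (2 ^ (-(k : ℝ))))) ∧
      ∀ f : RSpace d → ℂ, Continuous f → (∃ B : ℝ, ∀ z, ‖f z‖ ≤ B * decayWeight (N + 2) z) →
        Tendsto (fun j => c j • ∫ z, f ((r j)⁻¹ • (z - x)) • g z ∂κ) atTop
          (𝓝 ((∫ z, f z ∂ν) • g x)) := by
  obtain ⟨N, C, r, hC, hr, hanti, hr0, hr1, hgrow, hdown⟩ := exists_scales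
    (h := fun r => κ.real (Metric.closedBall x r)) (M := κ.real Set.univ)
    (fun s t hst => measureReal_mono (Metric.closedBall_subset_closedBall hst))
    (fun s hs => ENNReal.toReal_pos (hpos s hs).ne' (measure_ne_top _ _))
    (fun s => measureReal_mono (Set.subset_univ _)) (NNReal.coe_pos.2 hβ) hβγ (by
      refine (hfreq.and_eventually self_mem_nhdsWithin).mono fun s ⟨hs, hs0⟩ => ?_
      rw [ENNReal.ofReal_rpow_of_pos hs0] at hs
      exact (ENNReal.ofReal_lt_iff_lt_toReal (Real.rpow_nonneg (le_of_lt hs0) _)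
        (measure_ne_top _ _)).1 hs)
  let T : ℕ → RSpace d → RSpace d := fun j z => (r j)⁻¹ • (z - x)
  have hT : ∀ j, Measurable (T j) := fun j => by fun_prop
  have hball : ∀ j R, T j ⁻¹' Metric.closedBall 0 R = Metric.closedBall x (R * r j) := fun j R =>
    preimage_rescale_closedBall x (hr j) R
  let κ' : ℕ → Measure (RSpace d) := fun j => κ.map (T j)
  have hκ' : ∀ j R, κ' j (Metric.closedBall 0 R) = κ (Metric.closedBall x (R * r j)) := fun j R => by
    rw [Measure.map_apply (hT j) Metric.isClosed_closedBall.measurableSet, hball]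
  have hfin : ∀ j, IsFiniteMeasure (κ' j) := fun j => inferInstance
  have hgrow' : ∀ j, ∀ R : ℝ, 1 ≤ R → κ' j (Metric.closedBall 0 R) ≤
      C.toNNReal * κ' j (Metric.closedBall 0 1) * ENNReal.ofReal R ^ N := by
    intro j R hR
    have h1 := ENNReal.ofReal_le_ofReal (hgrow j R hR)
    rw [ENNReal.ofReal_mul (by positivity), ENNReal.ofReal_mul hC.le,
      ENNReal.ofReal_pow (by positivity), ofReal_measureReal, ofReal_measureReal] at h1
    rw [hκ', hκ', one_mul]
    refine h1.trans_eq ?_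
    rw [mul_right_comm]
    rfl
  obtain ⟨c, φ, ν, hφ, hν, hc, hcκ, hconv, D, hD, hlow⟩ := exists_tempered_limit
    (κ := κ') (N := N) (C := C.toNNReal) (fun j => by rw [hκ']; exact hpos _ (by simpa using hr j))
    hgrow'
  refine ⟨c ∘ φ, r ∘ φ, N, 2 ^ (N + 2) * C / κ.real (Metric.closedBall x 1), ν, fun j => hc _,
    fun j => hr _, fun j => hr1 _, hanti.comp_strictMono hφ, hr0.comp hφ.tendsto_atTop, ?_, hν,
    ⟨D, hD, fun k => ?_⟩, ?_⟩
  · intro j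
    set i := φ j
    have h1 : 0 < κ.real (Metric.closedBall x 1) :=
      ENNReal.toReal_pos (hpos 1 one_pos).ne' (measure_ne_top _ _)
    -- Growth with `R = 1 / r i` compares the ball of radius `r i` with the unit ball, so `c i` is
    -- at most of order `r i ^ (-N)`.
    have h2 := hgrow i (r i)⁻¹ ((one_le_inv₀ (hr i)).2 (hr1 i))
    simp only [inv_mul_cancel₀ (hr i).ne'] at h2
    have h3 : c i * κ.real (Metric.closedBall x (r i)) ≤ 2 ^ (N + 2) := by
      have h := hcκ i
      rw [hκ', one_mul, ← ofReal_measureReal, ← ENNReal.ofReal_mul (hc i).le,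
        ENNReal.ofReal_le_iff_le_toReal (by finiteness)] at h
      simpa using h
    change c i * r i ^ N ≤ _
    have hri := hr i
    have hci := hc i
    rw [le_div_iff₀ h1]
    calc c i * r i ^ N * κ.real (Metric.closedBall x 1)
        ≤ c i * r i ^ N * (C * (r i)⁻¹ ^ N * κ.real (Metric.closedBall x (r i))) := by gcongr
      _ = C * (c i * κ.real (Metric.closedBall x (r i))) * (r i ^ N * (r i)⁻¹ ^ N) := by ring
      _ = C * (c i * κ.real (Metric.closedBall x (r i))) := by
          rw [← mul_pow, mul_inv_cancel₀ hri.ne', one_pow, mul_one]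
      _ ≤ C * 2 ^ (N + 2) := by gcongr
      _ = _ := mul_comm _ _
  · refine hlow _ _ (Real.rpow_le_one_of_one_le_of_nonpos (by norm_num) (by simp)) ?_
    filter_upwards [eventually_ge_atTop k] with j hj
    have h1 := ENNReal.ofReal_le_ofReal (hdown j k hj)
    rw [ENNReal.ofReal_mul (by positivity), ofReal_measureReal, ofReal_measureReal] at h1
    rwa [hκ', hκ', one_mul]
  · rintro f hf ⟨B, hB⟩
    have hgx : Integrable (fun z => g z - g x) κ := hg.sub (integrable_const _)
    let τ : Measure (RSpace d) := κ.withDensity fun z => ‖g z - g x‖ₑ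
    have hτ : ∀ s, τ (Metric.closedBall x s) = ∫⁻ y in Metric.closedBall x s, ‖g y - g x‖ₑ ∂κ :=
      fun s => withDensity_apply _ Metric.isClosed_closedBall.measurableSet
    have hτfin : IsFiniteMeasure τ := isFiniteMeasure_withDensity hgx.2.ne
    simp_rw [← hτ] at hlim
    obtain ⟨E, hE, hτE⟩ := exists_measure_mul_bound_of_tendsto_div hpos hlim
    -- The rescaled error of replacing `g` by `g x`. It tends to 0 on each ball by the Lebesgue
    -- point property and has uniform growth, so its weighted mass tends to 0.
    let m : ℕ → Measure (RSpace d) := fun j => ENNReal.ofReal (c (φ j)) • τ.map (T (φ j))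
    have hm : ∀ j R, m j (Metric.closedBall 0 R) =
        ENNReal.ofReal (c (φ j)) * τ (Metric.closedBall x (R * r (φ j))) := fun j R => by
      simp only [m, Measure.smul_apply, smul_eq_mul]
      rw [Measure.map_apply (hT _) Metric.isClosed_closedBall.measurableSet, hball]
    have hcκ' : ∀ j, ∀ R : ℝ, 1 ≤ R → ENNReal.ofReal (c (φ j)) *
        κ (Metric.closedBall x (R * r (φ j))) ≤
          2 ^ (N + 2) * C.toNNReal * ENNReal.ofReal R ^ N := by
      intro j R hR
      rw [← hκ']
      calc _ ≤ ENNReal.ofReal (c (φ j)) * (C.toNNReal * κ' (φ j) (Metric.closedBall 0 1) *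
            ENNReal.ofReal R ^ N) := by gcongr; exact hgrow' _ R hR
        _ = ENNReal.ofReal (c (φ j)) * κ' (φ j) (Metric.closedBall 0 1) * C.toNNReal *
            ENNReal.ofReal R ^ N := by ring
        _ ≤ _ := by gcongr; exact hcκ _
    have herr : Tendsto (fun j => ∫⁻ z, ENNReal.ofReal (decayWeight (N + 2) z) ∂m j) atTop
        (𝓝 0) := by
      refine tendsto_lintegral_decayWeight_zero (M := E * (2 ^ (N + 2) * C.toNNReal))
        (ENNReal.mul_ne_top hE (by finiteness)) (fun j R hR => ?_) fun R hR => ?_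
      · rw [hm]
        have hR0 : 0 < R * r (φ j) := mul_pos (one_pos.trans_le hR) (hr _)
        calc _ ≤ ENNReal.ofReal (c (φ j)) * (E * κ (Metric.closedBall x (R * r (φ j)))) := by
              gcongr; exact hτE _ hR0
          _ = E * (ENNReal.ofReal (c (φ j)) * κ (Metric.closedBall x (R * r (φ j)))) := by ring
          _ ≤ E * (2 ^ (N + 2) * C.toNNReal * ENNReal.ofReal R ^ N) :=
              mul_le_mul' le_rfl (hcκ' j R hR)
          _ = _ := by ring
      · set M : ℝ≥0∞ := 2 ^ (N + 2) * C.toNNReal * ENNReal.ofReal (max R 1) ^ N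
        have hM : M ≠ ∞ := by finiteness
        have hs : Tendsto (fun j => R * r (φ j)) atTop (𝓝[>] 0) := by
          refine tendsto_nhdsWithin_iff.2 ⟨?_, Eventually.of_forall fun j => mul_pos hR (hr _)⟩
          simpa using (hr0.comp hφ.tendsto_atTop).const_mul R
        have h1 := ENNReal.Tendsto.const_mul (hlim.comp hs) (Or.inr hM)
        rw [mul_zero] at h1
        refine tendsto_of_tendsto_of_tendsto_of_le_of_le tendsto_const_nhds h1
          (fun _ => zero_le) fun j => ?_
        have hR0 : 0 < R * r (φ j) := mul_pos hR (hr _)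
        simp only [hm, Function.comp_apply]
        set b := κ (Metric.closedBall x (R * r (φ j))) with hb
        have hb0 : b ≠ 0 := (hpos _ hR0).ne'
        have hb1 : b ≤ κ (Metric.closedBall x (max R 1 * r (φ j))) := by
          have := (hr (φ j)).le
          refine measure_mono (Metric.closedBall_subset_closedBall ?_)
          gcongr
          exact le_max_left _ _
        calc ENNReal.ofReal (c (φ j)) * τ (Metric.closedBall x (R * r (φ j)))
            = ENNReal.ofReal (c (φ j)) * b * (τ (Metric.closedBall x (R * r (φ j))) / b) := by
              rw [mul_assoc, ENNReal.mul_div_cancel hb0 (measure_ne_top _ _)]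
          _ ≤ M * (τ (Metric.closedBall x (R * r (φ j))) / b) := by
              gcongr
              exact le_trans (by gcongr) (hcκ' j _ (le_max_right _ _))
    have hfb : ∀ z, ‖f z‖ ≤ |B| := fun z => (hB z).trans (by
      have h1 := decayWeight_le_one (N + 2) z
      have h2 := (decayWeight_pos (N + 2) z).le
      calc B * decayWeight (N + 2) z ≤ |B| * 1 := by
            gcongr
            exact le_abs_self B
        _ = |B| := mul_one _)
    have hfT : ∀ j, Continuous fun z => f (T j z) := fun j => by fun_prop
    have hi1 : ∀ j, Integrable (fun z => f (T j z)) κ := fun j =>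
      Integrable.of_bound (hfT j).aestronglyMeasurable |B| (Eventually.of_forall fun z => hfb _)
    have hi2 : ∀ j, Integrable (fun z => f (T j z) • (g z - g x)) κ := fun j =>
      hgx.bdd_smul |B| (hfT j).aestronglyMeasurable (Eventually.of_forall fun z => hfb _)
    have hsplit : ∀ j, c (φ j) • ∫ z, f (T (φ j) z) • g z ∂κ =
        (c (φ j) • ∫ z, f z ∂κ' (φ j)) • g x +
          c (φ j) • ∫ z, f (T (φ j) z) • (g z - g x) ∂κ := by
      intro j
      have e1 : ∫ z, f z ∂κ' (φ j) = ∫ z, f (T (φ j) z) ∂κ :=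
        integral_map (hT _).aemeasurable hf.aestronglyMeasurable
      rw [e1, smul_assoc, ← smul_add, ← integral_smul_const,
        ← integral_add ((hi1 _).smul_const _) (hi2 _)]
      congr 2
      ext1 z
      rw [← smul_add, add_sub_cancel]
    have hsmall : Tendsto (fun j => c (φ j) • ∫ z, f (T (φ j) z) • (g z - g x) ∂κ) atTop
        (𝓝 0) := by
      rw [tendsto_zero_iff_enorm_tendsto_zero]
      have h1 := ENNReal.Tendsto.const_mul herr (Or.inr (ENNReal.ofReal_ne_top (r := |B|)))
      rw [mul_zero] at h1
      refine tendsto_of_tendsto_of_tendsto_of_le_of_le tendsto_const_nhds h1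
        (fun _ => zero_le) fun j => ?_
      have hwm : Measurable fun z : RSpace d => ENNReal.ofReal (decayWeight (N + 2) z) :=
        (continuous_decayWeight _).measurable.ennreal_ofReal
      have e2 : ∫⁻ z, ENNReal.ofReal (decayWeight (N + 2) z) ∂m j = ENNReal.ofReal (c (φ j)) *
          ∫⁻ z, ‖g z - g x‖ₑ * ENNReal.ofReal (decayWeight (N + 2) (T (φ j) z)) ∂κ := by
        simp only [m]
        rw [lintegral_smul_measure, lintegral_map hwm (hT _),
          lintegral_withDensity_eq_lintegral_mul₀ hgx.1.enorm
            (g := fun z => ENNReal.ofReal (decayWeight (N + 2) (T (φ j) z)))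
            (hwm.comp (hT _)).aemeasurable]
        rfl
      simp only
      rw [e2, enorm_smul, Real.enorm_of_nonneg (hc _).le, mul_left_comm]
      gcongr
      rw [← lintegral_const_mul' _ _ ENNReal.ofReal_ne_top]
      refine (enorm_integral_le_lintegral_enorm _).trans (lintegral_mono fun z => ?_)
      rw [enorm_smul, mul_left_comm, mul_comm]
      gcongr
      rw [← ENNReal.ofReal_mul (abs_nonneg B), ← ofReal_norm]
      refine ENNReal.ofReal_le_ofReal ((hB _).trans ?_)
      have h2 := (decayWeight_pos (N + 2) (T (φ j) z)).le
      gcongr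
      exact le_abs_self B
    have hmain := ((hconv f hf ⟨B, hB⟩).smul_const (g x)).add hsmall
    rw [add_zero] at hmain
    exact hmain.congr fun j => (hsplit j).symm

/-- Dyadic radii suffice for a `liminf`, and the gap between `γ` and `γ'` absorbs the constant `D`.
-/
theorem localLowerDimH_le_of_forall_le {d : ℕ} {ν : Measure (RSpace d)} {x : RSpace d}
    {D : ℝ≥0∞} (hD : D ≠ 0) {γ γ' : ℝ} (hγ : γ < γ')
    (h : ∀ k : ℕ, D * ENNReal.ofReal (2 ^ (-(γ * k))) ≤
      ν (Metric.closedBall x (2 ^ (-(k : ℝ))))) :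
    localLowerDimH ν x ≤ (γ' : EReal) := by
  obtain ⟨δ, hδ0, hδ⟩ : ∃ δ : ℝ, 0 < δ ∧ ENNReal.ofReal δ ≤ D := by
    refine ⟨(min D 1).toReal, ENNReal.toReal_pos (by simp [hD]) (by simp), ?_⟩
    rw [ENNReal.ofReal_toReal (by simp)]
    exact min_le_left _ _
  have hlog2 : 0 < Real.log 2 := Real.log_pos (by norm_num)
  have hlim : Tendsto (fun k : ℕ => (2 : ℝ) ^ (-(k : ℝ))) atTop (𝓝[>] 0) := by
    refine tendsto_nhdsWithin_iff.2 ⟨?_, Eventually.of_forall fun k => ?_⟩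
    · exact (tendsto_rpow_atBot_of_base_gt_one 2 one_lt_two).comp
        (tendsto_neg_atTop_atBot.comp tendsto_natCast_atTop_atTop)
    · exact Real.rpow_pos_of_pos two_pos _
  refine liminf_le_of_frequently_le' (hlim.frequently (Eventually.frequently ?_))
  filter_upwards [eventually_gt_atTop 0,
    eventually_ge_atTop ⌈- Real.log δ / ((γ' - γ) * Real.log 2)⌉₊] with k hk0 hk
  have hk0' : (0 : ℝ) < k := by exact_mod_cast hk0
  have hk' : - Real.log δ ≤ (γ' - γ) * k * Real.log 2 := by
    have h1 := Nat.ceil_le.1 hk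
    rw [div_le_iff₀ (mul_pos (sub_pos.2 hγ) hlog2)] at h1
    linarith
  have hlogr : Real.log ((2 : ℝ) ^ (-(k : ℝ))) = -(k * Real.log 2) := by
    rw [Real.log_rpow two_pos]; ring
  have h1 : ((Real.log δ - γ * k * Real.log 2 : ℝ) : EReal) ≤
      ENNReal.log (ν (Metric.closedBall x (2 ^ (-(k : ℝ))))) := by
    have h2 : ENNReal.ofReal (δ * 2 ^ (-(γ * k))) ≤
        ν (Metric.closedBall x (2 ^ (-(k : ℝ)))) := by
      rw [ENNReal.ofReal_mul hδ0.le]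
      exact le_trans (by gcongr) (h k)
    refine le_trans (le_of_eq ?_) (ENNReal.log_le_log h2)
    have h3 : (0 : ℝ) < 2 ^ (-(γ * k)) := Real.rpow_pos_of_pos two_pos _
    rw [ENNReal.log_ofReal_of_pos (mul_pos hδ0 h3), Real.log_mul hδ0.ne' h3.ne',
      Real.log_rpow two_pos]
    congr 1
    ring
  rw [hlogr]
  have hneg : -(k * Real.log 2) < 0 := neg_lt_zero.2 (mul_pos hk0' hlog2)
  refine (EReal.div_le_div_right_of_nonpos (by exact_mod_cast hneg.le) h1).trans ?_
  rw [← EReal.coe_div, EReal.coe_le_coe_iff, div_le_iff_of_neg hneg]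
  linarith

theorem exists_norm_le_mul_decayWeight_of_hasCompactSupport {d : ℕ} {f : RSpace d → ℂ}
    (hf : Continuous f) (hc : HasCompactSupport f) (n : ℕ) :
    ∃ B : ℝ, ∀ z, ‖f z‖ ≤ B * decayWeight n z := by
  have h0 : ∀ z : RSpace d, decayWeight n z ≠ 0 := fun z => (decayWeight_pos n z).ne'
  obtain ⟨B, hB⟩ := (HasCompactSupport.smul_left (f := fun z => (decayWeight n z)⁻¹)
    hc).exists_bound_of_continuous (((continuous_decayWeight n).inv₀ h0).smul hf)
  refine ⟨B, fun z => ?_⟩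
  have h1 := hB z
  rw [Pi.smul_apply', norm_smul, norm_inv, Real.norm_of_nonneg (decayWeight_pos n z).le,
    inv_mul_le_iff₀ (decayWeight_pos n z)] at h1
  rwa [mul_comm]

theorem SchwartzMap.exists_norm_le_mul_decayWeight {d : ℕ} (φ : 𝓢(RSpace d, ℂ)) (n : ℕ) :
    ∃ B : ℝ, ∀ z, ‖φ z‖ ≤ B * decayWeight n z := by
  refine ⟨2 ^ n * (Finset.Iic (n, 0)).sup (fun m : ℕ × ℕ => SchwartzMap.seminorm ℂ m.1 m.2) φ,
    fun z => ?_⟩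
  have h1 := SchwartzMap.one_add_le_sup_seminorm_apply (𝕜 := ℂ) (m := (n, 0)) (k := n) (n := 0)
    le_rfl le_rfl φ z
  rw [norm_iteratedFDeriv_zero] at h1
  rw [decayWeight, ← div_eq_mul_inv, le_div_iff₀ (by positivity), mul_comm]
  exact h1

/-! ### Charges under dilation, and the main theorem -/

namespace LocalCharge

variable {d l : ℕ}

theorem zero_apply (B : Set (RSpace d)) : (0 : LocalCharge d l) B = 0 := rfl

theorem tensor_apply (a : CSpace l) (ν : Measure (RSpace d)) [IsLocallyFiniteMeasure ν]
    {B : Set (RSpace d)} (hB : MeasurableSet B) (hb : Bornology.IsBounded B) :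
    tensor a ν B = ν.real B • a := if_pos ⟨hB, hb⟩

theorem integral_tensor (a : CSpace l) (ν : Measure (RSpace d)) [IsLocallyFiniteMeasure ν]
    {f : RSpace d → ℂ} (hf : Continuous f) (hc : HasCompactSupport f) :
    (tensor a ν).integral f = (∫ x, f x ∂ν) • a := by
  rw [integral_eq_of_density _ hf hc (κ := ν) (G := fun _ => a), integral_smul_const]
  · exact continuous_const.continuousOn.integrableOn_compact hc.isCompact
  · intro B hB hsub
    rw [tensor_apply _ _ hB (hc.isCompact.isBounded.subset hsub), setIntegral_const]

/-- The density is only required near `x`: when `R * r ≤ s`, the rescaled test function lives inside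
that ball. -/
theorem integral_smul_dilate (μ : LocalCharge d l) {κ : Measure (RSpace d)}
    {g : RSpace d → CSpace l} (hg : Integrable g κ) {x : RSpace d} {s : ℝ}
    (h : ∀ B, MeasurableSet B → B ⊆ Metric.closedBall x s → μ B = ∫ z in B, g z ∂κ)
    (c : ℝ) {r : ℝ} (hr : 0 < r) {f : RSpace d → ℂ} (hf : Continuous f)
    (hc : HasCompactSupport f) {R : ℝ} (hR : tsupport f ⊆ Metric.closedBall 0 R)
    (hRs : R * r ≤ s) :
    (c • μ.dilate x r).integral f = c • ∫ z, f (r⁻¹ • (z - x)) • g z ∂κ := by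
  let T : RSpace d ≃ₜ RSpace d :=
    (Homeomorph.subRight x).trans (Homeomorph.smulOfNeZero r⁻¹ (inv_ne_zero hr.ne'))
  have hT : ∀ z, T z = r⁻¹ • (z - x) := fun z => rfl
  have hTm : MeasurableEmbedding T := T.measurableEmbedding
  have hgT : ∀ z, g (x + r • T z) = g z := fun z => by
    rw [hT, smul_inv_smul₀ hr.ne', add_sub_cancel]
  rw [integral_eq_of_density _ hf hc (κ := κ.map T) (G := fun y => c • g (x + r • y)),
    hTm.integral_map, ← integral_smul]
  · refine integral_congr_ae (Eventually.of_forall fun z => ?_)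
    simp only [hgT]
    rw [smul_comm, hT]
  · refine Integrable.integrableOn ?_
    rw [hTm.integrable_map_iff]
    refine (hg.smul c).congr (Eventually.of_forall fun z => ?_)
    simp [hgT]
  · intro B hB hsub
    rw [hTm.setIntegral_map]
    simp only [hgT]
    rw [integral_smul, ← h _ (hTm.measurable hB)]
    · exact congrArg (c • ·) (if_pos ⟨hr, hB, hc.isCompact.isBounded.subset hsub⟩)
    · refine (Set.preimage_mono (hsub.trans hR)).trans ?_
      refine (preimage_rescale_closedBall x hr R).subset.trans ?_
      exact Metric.closedBall_subset_closedBall hRs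

theorem exists_apply_ne_zero {μ : LocalCharge d l} (hμ : μ ≠ 0) : ∃ B, μ B ≠ 0 := by
  by_contra! h
  exact hμ (LocalCharge.ext (funext h))

theorem measurableSet_isBounded_of_apply_ne_zero {μ : LocalCharge d l} {B : Set (RSpace d)}
    (hB : μ B ≠ 0) : MeasurableSet B ∧ Bornology.IsBounded B := by
  by_contra h
  exact hB (μ.eq_zero' B h)

theorem lowerDimH_ne_top {μ : LocalCharge d l} (hμ : μ ≠ 0) : μ.lowerDimH ≠ ∞ := by
  obtain ⟨B, hB⟩ := exists_apply_ne_zero hμ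
  have h1 : μ.lowerDimH ≤ dimH (Set.univ : Set (RSpace d)) :=
    sInf_le ⟨B, (measurableSet_isBounded_of_apply_ne_zero hB).1, dimH_mono (Set.subset_univ _), hB⟩
  rw [Real.dimH_univ_eq_finrank] at h1
  exact ne_top_of_le_ne_top (by simp) h1

theorem mem_support_variation {μ : LocalCharge d l} {x : RSpace d}
    (h : ∀ᶠ r in 𝓝[>] (0 : ℝ), μ (Metric.closedBall x r) ≠ 0) : x ∈ μ.variation.support := by
  rw [Measure.mem_support_iff_forall]
  intro U hU
  obtain ⟨s, hs, hsub⟩ := Metric.nhds_basis_closedBall.mem_iff.1 hU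
  obtain ⟨r, hr, hrs⟩ := (h.and (Ioo_mem_nhdsGT hs)).exists
  have h1 : 0 < ‖μ (Metric.closedBall x r)‖ₑ := by simpa using hr
  refine h1.trans_le ((μ.enorm_le_variation Metric.isClosed_closedBall.measurableSet).trans ?_)
  exact measure_mono ((Metric.closedBall_subset_closedBall hrs.2.le).trans hsub)

end LocalCharge

theorem theorem1p2 {d l : ℕ} (μ : LocalCharge d l) (hμ : μ ≠ 0) (ε : ℝ) (hε : 0 < ε) :
    ∃ x ∈ μ.variation.support, ∃ a : CSpace l, a ≠ 0 ∧
      ∃ (ν : Measure (RSpace d)) (_ : IsLocallyFiniteMeasure ν), ν ≠ 0 ∧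
        LocalCharge.tensor a ν ∈ μ.tangentCone x ∧
        (0 ∈ ν.support ∧ localLowerDimH ν 0 ≤ (μ.lowerDimH : EReal) + (ε : EReal)) ∧
        IsTempered ν ∧
        ∀ u : 𝓢'(RSpace d, CSpace l), μ.IsDistribution u → IsSchwartzTangent u x a ν := by
  obtain ⟨p, hp⟩ : ∃ p : ℝ≥0, (p : ℝ≥0∞) = μ.lowerDimH :=
    ⟨_, ENNReal.coe_toNNReal (LocalCharge.lowerDimH_ne_top hμ)⟩
  -- Three thirds of `ε`: from the dimension to `β`, from `β` to `γ`, and from `γ` to the final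
  -- exponent.
  let ε' : ℝ≥0 := ⟨ε / 3, by positivity⟩
  have hε' : (0 : ℝ≥0) < ε' := by
    rw [← NNReal.coe_pos]; change 0 < ε / 3; positivity
  let β : ℝ≥0 := p + ε'
  have hβ0 : 0 < β := add_pos_of_nonneg_of_pos zero_le hε'
  obtain ⟨α, ⟨F, hF, hFα, hμF⟩, hα⟩ : ∃ α ∈ {α | ∃ F : Set (RSpace d), MeasurableSet F ∧
      dimH F ≤ α ∧ μ F ≠ 0}, α < (β : ℝ≥0∞) := by
    refine sInf_lt_iff.1 (?_ : μ.lowerDimH < β)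
    rw [← hp]
    exact_mod_cast lt_add_of_pos_right p hε'
  have hβ : dimH F < β := hFα.trans_lt hα
  obtain ⟨R, hR⟩ :=
    (LocalCharge.measurableSet_isBounded_of_apply_ne_zero hμF).2.subset_closedBall 0
  let A : Set (RSpace d) := Metric.closedBall 0 (R + 2)
  have hA : MeasurableSet A := Metric.isClosed_closedBall.measurableSet
  obtain ⟨κ, hκ, g₀, hg₀, hdens⟩ := exists_finite_measure_withDensity (μ.restrict A)
  have hμA : ∀ B, MeasurableSet B → B ⊆ A → μ B = ∫ z in B, g₀ z ∂κ := by
    intro B hB hBA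
    rw [← withDensityᵥ_apply hg₀ hB, ← hdens]
    refine Eq.trans ?_ (if_pos ⟨hB, hA, Metric.isBounded_closedBall⟩).symm
    rw [Set.inter_eq_left.2 hBA]
  obtain ⟨x, hxF, hgx₀, hpos, hlim₀, hfreq⟩ := exists_good_point κ hg₀ hF hβ (by
    rw [← hμA F hF (hR.trans (Metric.closedBall_subset_closedBall (by linarith)))]
    exact hμF)
  have hxA : Metric.closedBall x 2 ⊆ A := by
    refine Metric.closedBall_subset_closedBall' ?_
    have : dist x 0 ≤ R := hR hxF
    linarith
  -- The cutoff leaves the charge unchanged on the unit ball. It makes `χ u` equal to the charge `g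
  -- κ` on all Schwartz functions, so only `(1 - χ) u` needs a separate estimate.
  let χ : ContDiffBump x := ⟨1, 2, one_pos, one_lt_two⟩
  have hχ1 : ∀ z ∈ Metric.closedBall x 1, χ z = 1 := fun z hz => χ.one_of_mem_closedBall hz
  let g : RSpace d → CSpace l := fun z => (χ z : ℂ) • g₀ z
  have hχc : Continuous fun z => (χ z : ℂ) := Complex.continuous_ofReal.comp χ.continuous
  have hg : Integrable g κ := hg₀.bdd_smul 1 hχc.aestronglyMeasurable
    (Eventually.of_forall fun z => by
      rw [Complex.norm_real, Real.norm_of_nonneg χ.nonneg]; exact χ.le_one)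
  have hgg₀ : ∀ z ∈ Metric.closedBall x 1, g z = g₀ z := fun z hz => by
    simp only [g, hχ1 z hz, Complex.ofReal_one, one_smul]
  have hgx : g x = g₀ x := hgg₀ x (Metric.mem_closedBall_self zero_le_one)
  have hμg : ∀ B, MeasurableSet B → B ⊆ Metric.closedBall x 1 → μ B = ∫ z in B, g z ∂κ := by
    intro B hB hsub
    rw [hμA B hB (hsub.trans ((Metric.closedBall_subset_closedBall (by norm_num)).trans hxA))]
    exact setIntegral_congr_fun hB fun z hz => (hgg₀ z (hsub hz)).symm
  have hlim : Tendsto (fun r => (∫⁻ y in Metric.closedBall x r, ‖g y - g x‖ₑ ∂κ) /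
      κ (Metric.closedBall x r)) (𝓝[>] 0) (𝓝 0) := by
    refine hlim₀.congr' ?_
    filter_upwards [Ioo_mem_nhdsGT one_pos] with r hr
    congr 1
    refine setLIntegral_congr_fun Metric.isClosed_closedBall.measurableSet fun z hz => ?_
    rw [hgx, hgg₀ z (Metric.closedBall_subset_closedBall hr.2.le hz)]
  have hxsupp : x ∈ μ.variation.support := by
    refine LocalCharge.mem_support_variation ?_
    filter_upwards [eventually_setIntegral_closedBall_ne_zero κ hg (hgx ▸ hgx₀) hpos hlim,
      Ioo_mem_nhdsGT one_pos] with r hr hr1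
    rwa [hμg _ Metric.isClosed_closedBall.measurableSet
      (Metric.closedBall_subset_closedBall hr1.2.le)]
  obtain ⟨c, r, N, K, ν, hc, hr, hr1, hanti, hr0, hcK, hν, ⟨D, hD, hlow⟩, hconv⟩ :=
    exists_blowup κ hg hpos hlim hβ0 (γ := β + ε / 3) (by linarith) hfreq
  have hνfin : IsLocallyFiniteMeasure ν := hν.isLocallyFiniteMeasure
  have hνpos : ∀ k : ℕ, 0 < ν (Metric.closedBall 0 (2 ^ (-(k : ℝ)))) := fun k =>
    lt_of_lt_of_le (ENNReal.mul_pos hD (by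
      simpa using Real.rpow_pos_of_pos two_pos _)) (hlow k)
  refine ⟨x, hxsupp, g x, hgx ▸ hgx₀, ν, hνfin, ?_, ⟨?_, c, r, hc, hr, hanti, hr0, ?_⟩,
    ⟨?_, ?_⟩, hν, ?_⟩
  · rintro rfl
    simpa using hνpos 0
  · intro h0
    have h1 : LocalCharge.tensor (g x) ν (Metric.closedBall 0 1) = 0 := by
      rw [h0, LocalCharge.zero_apply]
    rw [LocalCharge.tensor_apply _ _ Metric.isClosed_closedBall.measurableSet
      Metric.isBounded_closedBall, smul_eq_zero] at h1
    refine h1.elim (fun h2 => ?_) (hgx ▸ hgx₀)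
    have h3 := hνpos 0
    simp only [Nat.cast_zero, neg_zero, Real.rpow_zero] at h3
    exact (ENNReal.toReal_pos h3.ne' Metric.isBounded_closedBall.measure_lt_top.ne).ne' h2
  · intro f hf hfc
    rw [LocalCharge.integral_tensor _ _ hf hfc]
    refine (hconv f hf (exists_norm_le_mul_decayWeight_of_hasCompactSupport hf hfc _)).congr' ?_
    obtain ⟨S, hS⟩ := hfc.isCompact.isBounded.subset_closedBall 0
    have h1 : Tendsto (fun j => S * r j) atTop (𝓝 0) := by simpa using hr0.const_mul S
    filter_upwards [h1.eventually_le_const one_pos] with j hj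
    exact (LocalCharge.integral_smul_dilate μ hg hμg (c j) (hr j) hf hfc hS hj).symm
  · rw [Measure.mem_support_iff_forall]
    intro U hU
    obtain ⟨s, hs, hsub⟩ := Metric.nhds_basis_closedBall.mem_iff.1 hU
    obtain ⟨k, hk⟩ := exists_pow_lt_of_lt_one hs (show (2⁻¹ : ℝ) < 1 by norm_num)
    refine (hνpos k).trans_le (measure_mono (Set.Subset.trans ?_ hsub))
    refine Metric.closedBall_subset_closedBall ?_
    rw [Real.rpow_neg two_pos.le, Real.rpow_natCast, ← inv_pow]
    exact hk.le
  · rw [← hp]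
    refine (localLowerDimH_le_of_forall_le hD (γ' := p + ε) ?_ hlow).trans (le_of_eq ?_)
    · change (p : ℝ) + ε / 3 + ε / 3 < p + ε
      linarith
    · rw [EReal.coe_add]
      rfl
  · intro u hu
    refine ⟨c, r, hc, hr, hanti, hr0, fun φ => ?_⟩
    let χ' : RSpace d → ℂ := fun z => (χ z : ℂ)
    have hχ'supp : tsupport χ' ⊆ Metric.closedBall x 2 := by
      refine (closure_mono fun z hz => ?_).trans χ.tsupport_eq.subset
      simpa [χ'] using hz
    have hχ't : χ'.HasTemperateGrowth := by
      refine HasCompactSupport.hasTemperateGrowth ?_ (Complex.ofRealCLM.contDiff.comp χ.contDiff)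
      exact HasCompactSupport.of_support_subset_isCompact (isCompact_closedBall x 2)
        ((subset_tsupport _).trans hχ'supp)
    let η : RSpace d → ℂ := fun z => 1 - χ' z
    have hηt : η.HasTemperateGrowth := (Function.HasTemperateGrowth.const 1).sub hχ't
    have hη0 : ∀ z ∈ Metric.ball x 1, η z = 0 := fun z hz => by
      simp [η, χ', hχ1 z (Metric.ball_subset_closedBall hz)]
    have hnear : ∀ j, u (SchwartzMap.smulLeftCLM ℂ χ' (schwartzRescale x (r j) φ)) =
        ∫ z, φ ((r j)⁻¹ • (z - x)) • g z ∂κ := by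
      intro j
      set ψ := SchwartzMap.smulLeftCLM ℂ χ' (schwartzRescale x (r j) φ)
      have hψ : ∀ z, ψ z = χ' z * φ ((r j)⁻¹ • (z - x)) := fun z => by
        simp only [ψ]
        rw [SchwartzMap.smulLeftCLM_apply_apply hχ't, schwartzRescale_apply x (hr j), smul_eq_mul]
      have hψsupp : tsupport ψ ⊆ Metric.closedBall x 2 := by
        refine (closure_mono fun z hz => ?_).trans hχ'supp
        rw [Function.mem_support, hψ] at hz
        exact left_ne_zero_of_mul hz
      have hψc : HasCompactSupport ψ :=
        HasCompactSupport.of_support_subset_isCompact (isCompact_closedBall x 2)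
          ((subset_tsupport _).trans hψsupp)
      rw [hu ψ hψc, LocalCharge.integral_eq_of_density μ ψ.continuous hψc hg₀.integrableOn
        fun B hB hsub => hμA B hB (hsub.trans (hψsupp.trans hxA))]
      refine integral_congr_ae (Eventually.of_forall fun z => ?_)
      simp only [hψ, g]
      rw [mul_comm, mul_smul]
    have hfar : Tendsto (fun j => c j •
        u (SchwartzMap.smulLeftCLM ℂ η (schwartzRescale x (r j) φ))) atTop (𝓝 0) := by
      -- One power more than `c j * r j ^ N ≤ K` consumes, which leaves a factor `r j → 0`.
      obtain ⟨C, hC⟩ := exists_norm_smulLeftCLM_schwartzRescale_le u hηt one_pos hη0 φ (N + 1)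
      have h1 : Tendsto (fun j => |C| * K * r j) atTop (𝓝 0) := by
        simpa using hr0.const_mul (|C| * K)
      refine squeeze_zero_norm (fun j => ?_) h1
      have hrj := (hr j).le
      have hcj := (hc j).le
      rw [norm_smul, Real.norm_of_nonneg hcj]
      calc c j * ‖u (SchwartzMap.smulLeftCLM ℂ η (schwartzRescale x (r j) φ))‖
          ≤ c j * (|C| * r j ^ (N + 1)) := by
            gcongr
            refine (hC _ (hr j) (hr1 j)).trans ?_
            gcongr
            exact le_abs_self C
        _ = |C| * (c j * r j ^ N) * r j := by ring
        _ ≤ |C| * K * r j := by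
            gcongr
            exact hcK j
    have hsplit : ∀ j, c j • distributionDilate u x (r j) φ =
        c j • ∫ z, φ ((r j)⁻¹ • (z - x)) • g z ∂κ +
          c j • u (SchwartzMap.smulLeftCLM ℂ η (schwartzRescale x (r j) φ)) := by
      intro j
      rw [← hnear j, ← smul_add, ← map_add, distributionDilate]
      congr 2
      ext z
      rw [add_apply, SchwartzMap.smulLeftCLM_apply_apply hχ't,
        SchwartzMap.smulLeftCLM_apply_apply hηt, ← add_smul]
      simp [η]
    simp_rw [hsplit]
    simpa using (hconv φ φ.continuous (φ.exists_norm_le_mul_decayWeight _)).add hfar
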